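/- Let $n\in\{2,3\}$ and let $\Omega\subset\mathbb{R}^n$ be a bounded domain with Lipschitz boundary $\Gamma=\partial\Omega$ (for instance a possibly curvilinear Lipschitz polygon or polyhedron), such that the geodesic distance on $\Gamma$ is bounded by a constant times the Euclidean distance. Let $ds$ be the surface measure on $\Gamma$ and, for $\tau\subseteq\Gamma$ and $v:\tau\to\mathbb{R}$, put $$|v|_{1/2,\tau}^2=\int_\tau dt\int_\tau ds\,\frac{|v(t)-v(s)|^2}{|t-s|^n},\qquad \|v\|_{1/2,\tau}^2=\|v\|_{L^2(\tau)}^2+|v|_{1/2,\tau}^2,$$ and let $H^{1/2}(\Gamma)$ be the space of all $v\in L^2(\Gamma)$ with $|v|_{1/2,\Gamma}<\infty$. Let $\mathcal{T}_h$ be a finite conforming decomposition of $\Gamma$ into possibly curvilinear segments ($n=2$) or triangles ($n=3$): each $T\in\mathcal{T}_h$ is the image of the reference simplex $\hat T$ under an injective continuous map $F_T$, and each common point of two distinct elements lies in a common proper face (vertex or edge) of both. Let $h=\max_T\operatorname{diam}T$, let $\mathcal{N}$ be the set of vertices of elements (nodes), and for $y\in\mathcal{N}$ let $\omega_y$ be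 the union of the elements that have $y$ as a vertex. The mesh is shape regular and quasi-uniform with constant $\kappa$ if $$\kappa^{-1}\operatorname{diam}(T)\,|a-b|\le|F_T(a)-F_T(b)|\le\kappa\operatorname{diam}(T)\,|a-b|\quad(a,b\in\hat T),\qquad h\le\kappa\operatorname{diam}T,$$ for all $T\in\mathcal{T}_h$. Then for all constants $\kappa$ and $c$ there is a constant $C>0$, depending only on $\Omega$, $\kappa$ and $c$ (in particular, not on $h$), such that the following holds for every mesh $\mathcal{T}_h$ of $\Gamma$ that is shape regular and quasi-uniform with constant $\kappa$. Let $\{\phi^\star_y\}_{y\in\mathcal{N}}\subset L^2(\Gamma)$ be functions, not necessarily linearly independent, with $$\int_\Gamma\phi^\star_y\,ds=1,\qquad \operatorname{supp}\phi^\star_y\subseteq\omega_y,\qquad c^{-1}h^{1/2-n/2}\le\|\phi^\star_y\|_{L^2(\omega_y)}\le c\,h^{1/2-n/2}\qquad\text{for all }y\in\mathcal{N}.$$ Then every $w\in H^{1/2}(\Gamma)$ with $\int_\Gamma w\,\phi^\star_y\,ds=0$ for all $y\in\mathcal{N}$ satisfies $$C^{-1}\sum_{y\in\mathcal{N}}|w|_{1/2,\omega_y}^2\;\le\;\|w\|_{1/2,\Gamma}^2\;\le\;C\sum_{y\in\mathcal{N}}|w|_{1/2,\omega_y}^2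 .$$ -/

import Mathlib

open MeasureTheory
open scoped ENNReal NNReal

namespace TraceNorm

noncomputable section

/-- The Euclidean space `ℝⁿ`. -/
abbrev Pt (n : ℕ) : Type := EuclideanSpace ℝ (Fin n)

/-! ### Domains -/

/-- `Ω` has a Lipschitz boundary: near each boundary point, in suitable orthonormal coordinates with
last axis `ν`, the set `Ω` is the strict subgraph of a Lipschitz function `ψ` of the other
coordinates (`z - ⟪ν, z⟫ ν` is the orthogonal projection of `z` to the hyperplane `ν^⊥`). -/
def HasLipschitzBoundary {n : ℕ} (Ω : Set (Pt n)) : Prop :=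
  ∀ x ∈ frontier Ω, ∃ (ν : Pt n) (ε : ℝ) (K : ℝ≥0) (ψ : Pt n → ℝ),
    ‖ν‖ = 1 ∧ 0 < ε ∧ LipschitzWith K ψ ∧
      ∀ z ∈ Metric.ball x ε, z ∈ Ω ↔ inner ℝ ν z < ψ (z - (inner ℝ ν z : ℝ) • ν)

/-- The geodesic distance of `x` and `y` in `S`: the infimum of the lengths of the curves in `S` that
join them (`∞` if there is no curve of finite length). -/
def geodesicEDist {n : ℕ} (S : Set (Pt n)) (x y : Pt n) : ℝ≥0∞ :=
  ⨅ γ : {γ : Path x y // ∀ t, γ t ∈ S}, eVariationOn (γ : Path x y) Set.univ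

/-- Bounded domains with Lipschitz boundary such that on the boundary the geodesic distance
is bounded by a constant times the Euclidean one. -/
structure IsAdmissibleDomain {n : ℕ} (Ω : Set (Pt n)) : Prop where
  isOpen : IsOpen Ω
  isConnected : IsConnected Ω
  isBounded : Bornology.IsBounded Ω
  lipschitz : HasLipschitzBoundary Ω
  nondegenerate : ∃ L : ℝ≥0, ∀ x ∈ frontier Ω, ∀ y ∈ frontier Ω,
    geodesicEDist (frontier Ω) x y ≤ L * edist x y

/-! ### Meshes -/

/-- The reference `(n-1)`-simplex, in barycentric coordinates: a segment for `n = 2`, a triangle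
for `n = 3`. -/
def refSimplex (n : ℕ) : Set (Pt n) :=
  {a | (∀ k, 0 ≤ a k) ∧ ∑ k, a k = 1}

/-- The vertices of the reference simplex. -/
def refVertex {n : ℕ} (k : Fin n) : Pt n := EuclideanSpace.single k 1

/-- The closed face of the reference simplex spanned by the vertices in `A`. -/
def refFace {n : ℕ} (A : Finset (Fin n)) : Set (Pt n) :=
  {a | a ∈ refSimplex n ∧ ∀ k, k ∉ A → a k = 0}

/-- A decomposition of `S` into finitely many (possibly curvilinear) segments (`n = 2`) or
triangles (`n = 3`). Each element is a homeomorphic image of the reference simplex, and distinct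
elements meet only in common proper faces. -/
structure Mesh {n : ℕ} (S : Set (Pt n)) where
  /-- the number of elements -/
  size : ℕ
  /-- the parametrizations of the elements -/
  param : Fin size → Pt n → Pt n
  continuousOn : ∀ i, ContinuousOn (param i) (refSimplex n)
  injOn : ∀ i, Set.InjOn (param i) (refSimplex n)
  cover : ⋃ i, param i '' refSimplex n = S
  conforming : ∀ i j, i ≠ j → ∀ x ∈ param i '' refSimplex n, x ∈ param j '' refSimplex n →
    ∃ A B : Finset (Fin n), A ≠ Finset.univ ∧ B ≠ Finset.univ ∧
      x ∈ param i '' refFace A ∧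
      param i '' refFace A = param j '' refFace B ∧
      (fun k => param i (refVertex k)) '' (A : Set (Fin n)) =
        (fun k => param j (refVertex k)) '' (B : Set (Fin n))

namespace Mesh

variable {n : ℕ} {S : Set (Pt n)}

/-- The `i`-th element `T` of the mesh (a closed set). -/
def element (M : Mesh S) (i : Fin M.size) : Set (Pt n) := M.param i '' refSimplex n

/-- The `k`-th vertex of the `i`-th element. -/
def vertex (M : Mesh S) (i : Fin M.size) (k : Fin n) : Pt n := M.param i (refVertex k)

open Classical in
/-- The set of nodes, that is, of vertices of elements. -/
def nodes (M : Mesh S) : Finset (Pt n) :=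
  Finset.univ.image fun p : Fin M.size × Fin n => M.vertex p.1 p.2

/-- The patch `ω_y`: the union of the elements that have `y` as a vertex. -/
def patch (M : Mesh S) (y : Pt n) : Set (Pt n) :=
  ⋃ (i : Fin M.size) (_ : ∃ k, M.vertex i k = y), M.element i

/-- The mesh size `h`, the largest diameter of an element. -/
def meshSize (M : Mesh S) : ℝ := ⨆ i, Metric.diam (M.element i)

/-- Shape regularity with constant `κ`: after scaling by its diameter, each element is the image of
the reference simplex under a bi-Lipschitz map with constants `κ⁻¹` and `κ`. (For straight
elements this is the usual bound on the ratio of the diameter and the inradius.) -/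
def IsShapeRegular (M : Mesh S) (κ : ℝ) : Prop :=
  ∀ i, ∀ a ∈ refSimplex n, ∀ b ∈ refSimplex n,
    κ⁻¹ * Metric.diam (M.element i) * dist a b ≤ dist (M.param i a) (M.param i b) ∧
      dist (M.param i a) (M.param i b) ≤ κ * Metric.diam (M.element i) * dist a b

/-- Quasi-uniformity with constant `κ`: the diameters of all elements are comparable to `h`. -/
def IsQuasiUniform (M : Mesh S) (κ : ℝ) : Prop :=
  ∀ i, M.meshSize ≤ κ * Metric.diam (M.element i)

end Mesh

/-! ### Norms -/

/-- The surface measure `ds` on `Γ ⊆ ℝⁿ`: the `(n-1)`-dimensional Hausdorff measure, normalized to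
agree with Lebesgue measure on hyperplanes. -/
def surfaceMeasure {n : ℕ} (Γ : Set (Pt n)) : Measure (Pt n) := (μHE[n - 1]).restrict Γ

/-- The squared seminorm `|v|²_{1/2,τ} = ∫_τ dt ∫_τ ds |v(t) - v(s)|² / |t - s|ⁿ`, with values
in `[0, ∞]`. -/
def halfSeminormSq {n : ℕ} (τ : Set (Pt n)) (v : Pt n → ℝ) : ℝ≥0∞ :=
  ∫⁻ t, ∫⁻ s, ENNReal.ofReal (|v t - v s| ^ 2 / ‖t - s‖ ^ n) ∂surfaceMeasure τ ∂surfaceMeasure τ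

/-- The squared norm `‖v‖²_{1/2,τ} = ‖v‖²_{0,τ} + |v|²_{1/2,τ}`. -/
def halfNormSq {n : ℕ} (τ : Set (Pt n)) (v : Pt n → ℝ) : ℝ≥0∞ :=
  eLpNorm v 2 (surfaceMeasure τ) ^ 2 + halfSeminormSq τ v

/-- `v ∈ H^{1/2}(τ)`. -/
def MemHalf {n : ℕ} (τ : Set (Pt n)) (v : Pt n → ℝ) : Prop :=
  MemLp v 2 (surfaceMeasure τ) ∧ halfSeminormSq τ v < ∞

end

end TraceNorm

namespace TraceNorm

/-! ### Upper regularity of the surface measure -/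

/-! Both estimates come from comparing `Γ × Γ` with the union of the squares `ω_y × ω_y`.

The first uses a Poincaré inequality. As `φ_y` has integral one and is orthogonal to `w`, `w t = ∫
(w t - w s) φ_y s ds`. Cauchy–Schwarz, `|t - s| ≤ 2h` on `ω_y` and `‖φ_y‖² ≤ c² h^(1-n)` bound the
squared `L²` norm of `w` on `ω_y` by `c² 2ⁿ h` times its squared seminorm there
(`enorm_sq_le_of_integral_mul_eq_zero`, `Mesh.eLpNorm_sq_le_sum`). In the double integral over `Γ ×
Γ`, pairs closer than `δh` lie in a common patch (`Mesh.exists_isCaptured`). The other pairs cost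
`O(1/(δh))` times the squared `L²` norm of `w`, because the surface measure of a ball of radius `r`
is `O(r^(n-1))` (`setLIntegral_halfKernel_far_le`). The powers of `h` cancel.

The reverse estimate is bounded overlap: each point lies in at most `N` patches
(`Mesh.exists_card_patch_le`).

Both `δ` and `N` depend only on `n`, `κ` and the geodesic constant `L`. The geometric core is
`Mesh.exists_common_element`: a curve that leaves all elements containing `x` must cross a face that
does not contain `x`, so it has length at least of order `h` times the smallest nonzero barycentric
coordinate of `x`. -/

theorem euclideanHausdorffMeasure_image_le {X Y : Type*} [EMetricSpace X] [MeasurableSpace X]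
    [BorelSpace X] [EMetricSpace Y] [MeasurableSpace Y] [BorelSpace Y] {K : ℝ≥0} {f : X → Y}
    (hf : LipschitzWith K f) (d : ℕ) (s : Set X) :
    μHE[d] (f '' s) ≤ (K : ℝ≥0∞) ^ d * μHE[d] s := by
  have h := hf.hausdorffMeasure_image_le (d := d) (Nat.cast_nonneg d) s
  rw [ENNReal.rpow_natCast] at h
  simp only [Measure.euclideanHausdorffMeasure_def, Measure.smul_apply, ENNReal.smul_def,
    smul_eq_mul]
  calc _ ≤ _ := mul_le_mul_right h _
    _ = _ := by ring

/-- The part of a Lipschitz graph in a ball of radius `r` has measure `O(r ^ d)`. -/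
theorem exists_measure_graph_inter_ball_le {d : ℕ} [NeZero d] {ν : Pt (d + 1)} (hν : ‖ν‖ = 1)
    {K : ℝ≥0} {ψ : Pt (d + 1) → ℝ} (hψ : LipschitzWith K ψ) :
    ∃ A : ℝ≥0, ∀ x : Pt (d + 1), ∀ r : ℝ, 0 < r →
      μHE[d] ({z | inner ℝ ν z = ψ (z - (inner ℝ ν z : ℝ) • ν)} ∩ Metric.ball x r) ≤
        A * ENNReal.ofReal r ^ d := by
  have hν0 : ν ≠ 0 := by
    rintro rfl
    simp at hν
  have : Fact (Module.finrank ℝ (Pt (d + 1)) = d + 1) := ⟨by simp⟩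
  let ι := (OrthonormalBasis.fromOrthogonalSpanSingleton (𝕜 := ℝ) d hν0).repr
  -- The graph is parametrized over `ν^⊥`, identified isometrically with `ℝᵈ`; its part in a ball
  -- lies over a ball of the same radius, as the projection `P` does not increase distances.
  let g : Pt d → Pt (d + 1) := fun u => (ι.symm u : Pt (d + 1)) + ψ (ι.symm u) • ν
  have hιd : ∀ u v, ‖((ι.symm u : Pt (d + 1)) - ι.symm v)‖ = ‖u - v‖ := by
    intro u v
    rw [← ι.symm.norm_map (u - v), map_sub]
    rfl
  have hg : LipschitzWith (1 + K) g := by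
    refine LipschitzWith.of_dist_le_mul fun u v => ?_
    have h1 : dist (ψ (ι.symm u)) (ψ (ι.symm v)) ≤ K * dist u v := by
      have := hψ.dist_le_mul (ι.symm u : Pt (d + 1)) (ι.symm v)
      rwa [dist_eq_norm (ι.symm u : Pt (d + 1)), hιd, ← dist_eq_norm] at this
    have h2 : g u - g v =
        ((ι.symm u : Pt (d + 1)) - ι.symm v) + (ψ (ι.symm u) - ψ (ι.symm v)) • ν := by
      simp only [g]
      module
    rw [dist_eq_norm (g u), h2]
    refine (norm_add_le _ _).trans ?_
    rw [hιd, norm_smul, hν, mul_one, ← dist_eq_norm, ← dist_eq_norm]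
    push_cast
    linarith
  have hproj : ∀ z : Pt (d + 1), z - (inner ℝ ν z : ℝ) • ν ∈ (Submodule.span ℝ {ν})ᗮ := by
    intro z
    rw [Submodule.mem_orthogonal_singleton_iff_inner_right, inner_sub_right, inner_smul_right,
      real_inner_self_eq_norm_sq, hν]
    ring
  let P : Pt (d + 1) → Pt d := fun z => ι ⟨_, hproj z⟩
  have hP : ∀ z, (ι.symm (P z) : Pt (d + 1)) = z - (inner ℝ ν z : ℝ) • ν := by
    intro z
    simp [P]
  have hPd : ∀ z x, dist (P z) (P x) ≤ dist z x := by
    intro z x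
    rw [dist_eq_norm, ← hιd, hP, hP, dist_eq_norm]
    have h1 : z - (inner ℝ ν z : ℝ) • ν - (x - (inner ℝ ν x : ℝ) • ν) =
        (z - x) - (inner ℝ ν (z - x) : ℝ) • ν := by
      rw [inner_sub_right]
      module
    rw [h1]
    refine abs_le_of_sq_le_sq' ?_ (norm_nonneg _) |>.2
    rw [@norm_sub_sq_real, inner_smul_right, norm_smul, hν, real_inner_comm]
    simp only [Real.norm_eq_abs, mul_one, sq_abs]
    nlinarith [sq_nonneg (inner ℝ ν (z - x) : ℝ)]
  have hsub : ∀ x r, {z | inner ℝ ν z = ψ (z - (inner ℝ ν z : ℝ) • ν)} ∩ Metric.ball x r ⊆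
      g '' Metric.ball (P x) r := by
    rintro x r z ⟨hz, hzx⟩
    refine ⟨P z, (hPd z x).trans_lt hzx, ?_⟩
    simp only [g, hP]
    rw [← hz]
    module
  refine ⟨(1 + K) ^ d * (volume (Metric.ball (0 : Pt d) 1)).toNNReal, fun x r hr => ?_⟩
  calc _ ≤ μHE[d] (g '' Metric.ball (P x) r) := measure_mono (hsub x r)
    _ ≤ _ := euclideanHausdorffMeasure_image_le hg d _
    _ = _ := by
      rw [EuclideanSpace.euclideanHausdorffMeasure_eq_volume, Measure.addHaar_ball _ _ hr.le,
        ENNReal.coe_mul, ENNReal.coe_toNNReal Metric.isBounded_ball.measure_lt_top.ne,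
        ENNReal.ofReal_pow hr.le, finrank_euclideanSpace, Fintype.card_fin]
      push_cast
      ring

/-- Either strict inequality is an open condition and would place `z` in the interior of `Ω` or of
its complement. -/
theorem eq_of_mem_frontier {n : ℕ} {Ω : Set (Pt n)} {x ν : Pt n} {ε : ℝ} {ψ : Pt n → ℝ}
    (hψ : Continuous ψ)
    (h : ∀ z ∈ Metric.ball x ε, z ∈ Ω ↔ inner ℝ ν z < ψ (z - (inner ℝ ν z : ℝ) • ν))
    {z : Pt n} (hz : z ∈ frontier Ω) (hzx : z ∈ Metric.ball x ε) :
    inner ℝ ν z = ψ (z - (inner ℝ ν z : ℝ) • ν) := by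
  have hc1 : Continuous fun z : Pt n => (inner ℝ ν z : ℝ) := by fun_prop
  have hc2 : Continuous fun z : Pt n => ψ (z - (inner ℝ ν z : ℝ) • ν) := by fun_prop
  have hb : Metric.ball x ε ∈ nhds z := Metric.isOpen_ball.mem_nhds hzx
  rcases lt_trichotomy (inner ℝ ν z : ℝ) (ψ (z - (inner ℝ ν z : ℝ) • ν)) with hlt | heq | hgt
  · refine absurd ?_ hz.2
    rw [mem_interior_iff_mem_nhds]
    filter_upwards [hb, (isOpen_lt hc1 hc2).mem_nhds hlt] with p hp1 hp2
    exact (h p hp1).2 hp2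
  · exact heq
  · have : Ωᶜ ∈ nhds z := by
      filter_upwards [hb, (isOpen_lt hc2 hc1).mem_nhds hgt] with p hp1 hp2 hp3
      exact absurd ((h p hp1).1 hp3) (not_lt.2 (le_of_lt hp2))
    obtain ⟨p, hp1, hp2⟩ := mem_closure_iff_nhds.1 hz.1 _ this
    exact absurd hp2 hp1

/-- By compactness finitely many graphs cover the boundary, and their growth constants add up. -/
theorem exists_measure_frontier_inter_ball_le {d : ℕ} [NeZero d] {Ω : Set (Pt (d + 1))}
    (hb : Bornology.IsBounded Ω) (hΩ : HasLipschitzBoundary Ω) :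
    ∃ A : ℝ≥0, ∀ x : Pt (d + 1), ∀ r : ℝ, 0 < r →
      μHE[d] (frontier Ω ∩ Metric.ball x r) ≤ A * ENNReal.ofReal r ^ d := by
  have hK : IsCompact (frontier Ω) :=
    Metric.isCompact_of_isClosed_isBounded isClosed_frontier
      (hb.closure.subset frontier_subset_closure)
  refine hK.induction_on (p := fun s => ∃ A : ℝ≥0, ∀ x : Pt (d + 1), ∀ r : ℝ, 0 < r →
      μHE[d] (s ∩ Metric.ball x r) ≤ A * ENNReal.ofReal r ^ d) ?_ ?_ ?_ ?_
  · exact ⟨0, by simp⟩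
  · rintro s t hst ⟨A, hA⟩
    exact ⟨A, fun x r hr => (measure_mono (Set.inter_subset_inter_left _ hst)).trans (hA x r hr)⟩
  · rintro s t ⟨A, hA⟩ ⟨B, hB⟩
    refine ⟨A + B, fun x r hr => ?_⟩
    rw [Set.union_inter_distrib_right, ENNReal.coe_add, add_mul]
    exact (measure_union_le _ _).trans (add_le_add (hA x r hr) (hB x r hr))
  · intro x hx
    obtain ⟨ν, ε, K, ψ, hν, hε, hψ, h⟩ := hΩ x hx
    obtain ⟨A, hA⟩ := exists_measure_graph_inter_ball_le hν hψ
    refine ⟨frontier Ω ∩ Metric.ball x ε,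
      inter_mem_nhdsWithin _ (Metric.ball_mem_nhds x hε), A, fun y r hr => ?_⟩
    refine (measure_mono ?_).trans (hA y r hr)
    exact Set.inter_subset_inter_left _
      fun z hz => eq_of_mem_frontier hψ.continuous h hz.1 hz.2

/-- The integral of `|t - s| ^ (-(d + 1))` over the complement of a ball of radius `R` is
`O(1 / R)` for a measure with growth of order `d`. -/
theorem lintegral_compl_ball_le {n d : ℕ} {μ : Measure (Pt n)} {A : ℝ≥0}
    (hA : ∀ x : Pt n, ∀ r : ℝ, 0 < r → μ (Metric.ball x r) ≤ A * ENNReal.ofReal r ^ d)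
    (t : Pt n) {R : ℝ} (hR : 0 < R) :
    ∫⁻ s in {s | R ≤ ‖t - s‖}, ENNReal.ofReal (1 / ‖t - s‖ ^ (d + 1)) ∂μ ≤
      ENNReal.ofReal (A * 2 ^ (d + 1) / R) := by
  -- Dyadic shells: the measure of the `k`-th one is `O((2^k R)^d)` and the integrand is at most
  -- `(2^k R)^(-(d+1))`, which leaves a geometric series.
  let E : ℕ → Set (Pt n) := fun k => {s | 2 ^ k * R ≤ ‖t - s‖ ∧ ‖t - s‖ < 2 ^ (k + 1) * R}
  have hE : {s | R ≤ ‖t - s‖} ⊆ ⋃ k, E k := by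
    intro s hs
    have h1 : 1 ≤ ‖t - s‖ / R := (one_le_div hR).2 hs
    obtain ⟨k, hk1, hk2⟩ := exists_nat_pow_near h1 (one_lt_two : (1 : ℝ) < 2)
    exact Set.mem_iUnion.2 ⟨k, (le_div_iff₀ hR).1 hk1, (div_lt_iff₀ hR).1 hk2⟩
  have hEk : ∀ k, ∫⁻ s in E k, ENNReal.ofReal (1 / ‖t - s‖ ^ (d + 1)) ∂μ ≤
      ENNReal.ofReal (A * 2 ^ d / R * (1 / 2) ^ k) := by
    intro k
    have hk : 0 < 2 ^ k * R := by positivity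
    have hk' : 0 < 2 ^ (k + 1) * R := by positivity
    have hsub : E k ⊆ Metric.ball t (2 ^ (k + 1) * R) := by
      intro s hs
      rw [Metric.mem_ball, dist_comm, dist_eq_norm]
      exact hs.2
    calc _ ≤ ∫⁻ s in E k, ENNReal.ofReal (1 / (2 ^ k * R) ^ (d + 1)) ∂μ := by
          refine setLIntegral_mono measurable_const fun s hs => ?_
          refine ENNReal.ofReal_le_ofReal ?_
          exact one_div_le_one_div_of_le (by positivity) (pow_le_pow_left₀ hk.le hs.1 _)
      _ = ENNReal.ofReal (1 / (2 ^ k * R) ^ (d + 1)) * μ (E k) := by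
          rw [setLIntegral_const]
      _ ≤ ENNReal.ofReal (1 / (2 ^ k * R) ^ (d + 1)) *
          (A * ENNReal.ofReal (2 ^ (k + 1) * R) ^ d) :=
          mul_le_mul_right ((measure_mono hsub).trans (hA t _ hk')) _
      _ = _ := by
          rw [← ENNReal.ofReal_pow hk'.le, ← ENNReal.ofReal_coe_nnreal (p := A),
            ← ENNReal.ofReal_mul A.coe_nonneg, ← ENNReal.ofReal_mul (by positivity)]
          congr 1
          rw [one_div_pow]
          field_simp
          ring
  calc _ ≤ ∫⁻ s in ⋃ k, E k, ENNReal.ofReal (1 / ‖t - s‖ ^ (d + 1)) ∂μ :=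
        lintegral_mono_set hE
    _ ≤ ∑' k, ∫⁻ s in E k, ENNReal.ofReal (1 / ‖t - s‖ ^ (d + 1)) ∂μ := lintegral_iUnion_le _ _
    _ ≤ ∑' k : ℕ, ENNReal.ofReal (A * 2 ^ d / R * (1 / 2) ^ k) := ENNReal.tsum_le_tsum hEk
    _ = ENNReal.ofReal (∑' k : ℕ, A * 2 ^ d / R * (1 / 2) ^ k) :=
        (ENNReal.ofReal_tsum_of_nonneg (fun k => by positivity)
          (summable_geometric_two.mul_left _)).symm
    _ = _ := by
        rw [tsum_mul_left, tsum_geometric_two]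
        congr 1
        ring

/-! ### The reference simplex -/

theorem isCompact_refSimplex (n : ℕ) : IsCompact (refSimplex n) := by
  have : refSimplex n = (EuclideanSpace.equiv (Fin n) ℝ) ⁻¹' stdSimplex ℝ (Fin n) := by
    ext a
    simp [refSimplex, stdSimplex]
  rw [this]
  exact (EuclideanSpace.equiv (Fin n) ℝ).toHomeomorph.isCompact_preimage.2
    (isCompact_stdSimplex ℝ (Fin n))

theorem refVertex_mem {n : ℕ} (k : Fin n) : refVertex k ∈ refSimplex n := by
  refine ⟨fun l => ?_, ?_⟩
  · simp only [refVertex, PiLp.single_apply]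
    split_ifs <;> norm_num
  · simp [refVertex, PiLp.single_apply]

theorem refFace_subset {n : ℕ} (A : Finset (Fin n)) : refFace A ⊆ refSimplex n := fun _ h => h.1

theorem abs_sub_le_dist {n : ℕ} (a b : Pt n) (k : Fin n) : |a k - b k| ≤ dist a b := by
  rw [dist_eq_norm]
  exact PiLp.norm_apply_le (a - b) k

theorem le_one_of_mem_refSimplex {n : ℕ} {a : Pt n} (ha : a ∈ refSimplex n) (k : Fin n) :
    a k ≤ 1 :=
  ha.2 ▸ Finset.single_le_sum (f := fun k => a k) (fun l _ => ha.1 l) (Finset.mem_univ k)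

/-- Transferring the barycentric coordinate `m` to the coordinate `k` moves a point by at most
twice its value. -/
theorem dist_add_single_sub_single_le {n : ℕ} (a : Pt n) (c : ℝ) (hc : 0 ≤ c) (k m : Fin n) :
    dist a (a + EuclideanSpace.single k c - EuclideanSpace.single m c) ≤ 2 * c := by
  have h : a - (a + EuclideanSpace.single k c - EuclideanSpace.single m c) =
      EuclideanSpace.single m c - EuclideanSpace.single k c := by abel
  rw [dist_eq_norm, h]
  refine (norm_sub_le _ _).trans ?_
  simp only [PiLp.norm_single, Real.norm_eq_abs, abs_of_nonneg hc]
  linarith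

/-- The coordinates other than `k` add up to `1 - a k`, which is also the defect of the `k`-th one;
the triangle inequality adds the two. -/
theorem dist_refVertex_le {n : ℕ} {a : Pt n} (ha : a ∈ refSimplex n) (k : Fin n) :
    dist a (refVertex k) ≤ 2 * (1 - a k) := by
  have h1 := le_one_of_mem_refSimplex ha k
  have h2 : a - refVertex k = ∑ l, EuclideanSpace.single l ((a - refVertex k) l) := by
    ext j
    simp
  rw [dist_eq_norm, h2]
  refine (norm_sum_le _ _).trans ?_
  rw [← Finset.add_sum_erase _ _ (Finset.mem_univ k)]
  have h3 : ∑ l ∈ Finset.univ.erase k, ‖EuclideanSpace.single l ((a - refVertex k) l)‖ =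
      ∑ l ∈ Finset.univ.erase k, a l := by
    refine Finset.sum_congr rfl fun l hl => ?_
    have hlk : l ≠ k := Finset.ne_of_mem_erase hl
    simp [refVertex, hlk, abs_of_nonneg (ha.1 l)]
  have h4 : a k + ∑ l ∈ Finset.univ.erase k, a l = 1 := by
    rw [Finset.add_sum_erase _ (fun l => a l) (Finset.mem_univ k)]
    exact ha.2
  rw [h3]
  have h5 : ‖EuclideanSpace.single k ((a - refVertex k) k)‖ = 1 - a k := by
    simp only [PiLp.norm_single, Real.norm_eq_abs, PiLp.sub_apply, refVertex, PiLp.single_apply,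
      if_true]
    rw [abs_sub_comm, abs_of_nonneg (by linarith)]
  rw [h5]
  linarith

theorem one_le_dist_refVertex {n : ℕ} {k l : Fin n} (h : k ≠ l) :
    1 ≤ dist (refVertex k) (refVertex l) := by
  have := abs_sub_le_dist (refVertex k) (refVertex l) k
  simpa [refVertex, PiLp.single_apply, h] using this

/-! ### Geometry of meshes -/

namespace Mesh

variable {n : ℕ} {S : Set (Pt n)} (M : Mesh S)

theorem isCompact_element (i : Fin M.size) : IsCompact (M.element i) :=
  (isCompact_refSimplex n).image_of_continuousOn (M.continuousOn i)

theorem isCompact_patch (y : Pt n) : IsCompact (M.patch y) :=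
  (Set.toFinite _).isCompact_biUnion fun i _ => M.isCompact_element i

theorem element_subset (i : Fin M.size) : M.element i ⊆ S := by
  intro x hx
  have h : x ∈ ⋃ i, M.param i '' refSimplex n := Set.mem_iUnion.2 ⟨i, hx⟩
  rwa [M.cover] at h

theorem patch_subset (y : Pt n) : M.patch y ⊆ S :=
  Set.iUnion₂_subset fun i _ => M.element_subset i

theorem exists_param_eq {x : Pt n} (hx : x ∈ S) : ∃ i, ∃ a ∈ refSimplex n, M.param i a = x := by
  rw [← M.cover] at hx
  exact Set.mem_iUnion.1 hx

theorem vertex_mem_element (i : Fin M.size) (k : Fin n) : M.vertex i k ∈ M.element i :=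
  ⟨_, refVertex_mem k, rfl⟩

theorem vertex_mem_nodes (i : Fin M.size) (k : Fin n) : M.vertex i k ∈ M.nodes := by
  classical
  exact Finset.mem_image.2 ⟨(i, k), Finset.mem_univ _, rfl⟩

theorem exists_vertex_eq {y : Pt n} (hy : y ∈ M.nodes) : ∃ i k, M.vertex i k = y := by
  classical
  obtain ⟨p, -, hp⟩ := Finset.mem_image.1 hy
  exact ⟨p.1, p.2, hp⟩

theorem element_subset_patch (i : Fin M.size) (k : Fin n) :
    M.element i ⊆ M.patch (M.vertex i k) :=
  Set.subset_biUnion_of_mem (u := fun i => M.element i) (show ∃ l, M.vertex i l = _ from ⟨k, rfl⟩)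

theorem diam_element_le (i : Fin M.size) : Metric.diam (M.element i) ≤ M.meshSize :=
  le_ciSup (f := fun i => Metric.diam (M.element i)) (Set.finite_range _).bddAbove i

theorem dist_le_meshSize {i : Fin M.size} {x y : Pt n} (hx : x ∈ M.element i)
    (hy : y ∈ M.element i) : dist x y ≤ M.meshSize :=
  (Metric.dist_le_diam_of_mem (M.isCompact_element i).isBounded hx hy).trans (M.diam_element_le i)

theorem dist_le_of_mem_patch {x y : Pt n} (hx : x ∈ M.patch y) : dist x y ≤ M.meshSize := by
  obtain ⟨i, ⟨k, hk⟩, hx⟩ := Set.mem_iUnion₂.1 hx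
  exact M.dist_le_meshSize hx (hk ▸ M.vertex_mem_element i k)

theorem meshSize_pos (hn : 2 ≤ n) (i : Fin M.size) : 0 < M.meshSize := by
  have hne : refVertex (⟨0, by omega⟩ : Fin n) ≠ refVertex ⟨1, by omega⟩ := by
    rw [← dist_pos]
    exact one_pos.trans_le (one_le_dist_refVertex (by simp))
  have h : M.vertex i ⟨0, by omega⟩ ≠ M.vertex i ⟨1, by omega⟩ :=
    (M.injOn i).ne (refVertex_mem _) (refVertex_mem _) hne
  exact (dist_pos.2 h).trans_le
    (M.dist_le_meshSize (M.vertex_mem_element i _) (M.vertex_mem_element i _))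

variable {M} {κ : ℝ}

/-- A single element forces this, since `0 < h ≤ κ diam T ≤ κ h`. Hence for `κ < 1` only meshes
without elements are left. -/
theorem IsQuasiUniform.one_le (hq : M.IsQuasiUniform κ) (hn : 2 ≤ n) (i : Fin M.size) :
    1 ≤ κ := by
  have hpos := M.meshSize_pos hn i
  have h1 := hq i
  have h2 := M.diam_element_le i
  have h3 : 0 ≤ Metric.diam (M.element i) := Metric.diam_nonneg
  by_contra! h
  have h4 : 0 < Metric.diam (M.element i) := by nlinarith
  nlinarith

theorem dist_param_le (hs : M.IsShapeRegular κ) (hκ : 1 ≤ κ) (i : Fin M.size) {a b : Pt n}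
    (ha : a ∈ refSimplex n) (hb : b ∈ refSimplex n) :
    dist (M.param i a) (M.param i b) ≤ κ * M.meshSize * dist a b := by
  refine (hs i a ha b hb).2.trans ?_
  gcongr
  exact M.diam_element_le i

/-- One factor `κ⁻¹` is due to shape regularity, the other to replacing the diameter of the element
by `h`. -/
theorem le_dist_param (hs : M.IsShapeRegular κ) (hq : M.IsQuasiUniform κ) (hκ : 1 ≤ κ)
    (i : Fin M.size) {a b : Pt n} (ha : a ∈ refSimplex n) (hb : b ∈ refSimplex n) :
    (κ ^ 2)⁻¹ * M.meshSize * dist a b ≤ dist (M.param i a) (M.param i b) := by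
  refine le_trans ?_ (hs i a ha b hb).1
  have hκ0 : 0 < κ := by linarith
  have h1 : κ⁻¹ * M.meshSize ≤ Metric.diam (M.element i) := by
    rw [inv_mul_le_iff₀ hκ0]
    exact hq i
  have h2 : (κ ^ 2)⁻¹ * M.meshSize = κ⁻¹ * (κ⁻¹ * M.meshSize) := by
    rw [sq, mul_inv, mul_assoc]
  rw [h2]
  gcongr

/-- The closed sets `V` and `W`, the unions of the `T i` with and without `x`, cover the curve. It
starts in `V` and ends outside, so by connectedness the preimage of `V` has a frontier point, which
lies in both preimages. -/
theorem exists_mem_frontier_of_path {X ι : Type*} [TopologicalSpace X] [Finite ι] {T : ι → Set X}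
    (hT : ∀ i, IsClosed (T i)) {x p : X} (γ : Path x p) (hγ : ∀ t, γ t ∈ ⋃ i, T i)
    (hp : ∀ i, x ∈ T i → p ∉ T i) :
    ∃ t i j, x ∈ T i ∧ x ∉ T j ∧ γ t ∈ T i ∧ γ t ∈ T j := by
  let V : Set X := ⋃ i ∈ {i | x ∈ T i}, T i
  let W : Set X := ⋃ i ∈ {i | x ∉ T i}, T i
  have hV : IsClosed V := (Set.toFinite _).isClosed_biUnion fun i _ => hT i
  have hW : IsClosed W := (Set.toFinite _).isClosed_biUnion fun i _ => hT i
  have hVx : (γ ⁻¹' V).Nonempty := by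
    obtain ⟨i, hi⟩ := Set.mem_iUnion.1 (hγ 0)
    refine ⟨0, Set.mem_iUnion₂.2 ⟨i, ?_, hi⟩⟩
    simpa using hi
  have hVp : γ ⁻¹' V ≠ Set.univ := by
    intro h
    have h1 : (1 : unitInterval) ∈ γ ⁻¹' V := h ▸ Set.mem_univ _
    obtain ⟨i, hi, hi'⟩ := Set.mem_iUnion₂.1 h1
    exact hp i hi (by simpa using hi')
  obtain ⟨t, ht⟩ := nonempty_frontier_iff.2 ⟨hVx, hVp⟩
  have hVc : IsClosed (γ ⁻¹' V) := hV.preimage γ.continuous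
  have htV : t ∈ γ ⁻¹' V := hVc.frontier_subset ht
  have htW : t ∈ γ ⁻¹' W := by
    have h1 : t ∈ closure (γ ⁻¹' V)ᶜ := by
      rw [frontier_eq_closure_inter_closure] at ht
      exact ht.2
    refine closure_minimal ?_ (hW.preimage γ.continuous) h1
    intro s hs
    obtain ⟨i, hi⟩ := Set.mem_iUnion.1 (hγ s)
    refine Set.mem_iUnion₂.2 ⟨i, fun hx => hs ?_, hi⟩
    exact Set.mem_iUnion₂.2 ⟨i, hx, hi⟩
  obtain ⟨i, hi, hti⟩ := Set.mem_iUnion₂.1 htV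
  obtain ⟨j, hj, htj⟩ := Set.mem_iUnion₂.1 htW
  exact ⟨t, i, j, hi, hj, hti, htj⟩

/-- If the nonzero barycentric coordinates of `x` in the elements that contain it are at least
`θ`, then the points of `S` near `x` lie in a common element with `x`. -/
theorem exists_common_element {L : ℝ≥0}
    (hL : ∀ x ∈ S, ∀ y ∈ S, geodesicEDist S x y ≤ L * edist x y)
    (hs : M.IsShapeRegular κ) (hq : M.IsQuasiUniform κ) (hκ : 1 ≤ κ) {x p : Pt n} {θ : ℝ}
    (hθ : ∀ i, ∀ a ∈ refSimplex n, M.param i a = x → ∀ k, a k = 0 ∨ θ ≤ a k)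
    (hx : x ∈ S) (hp : p ∈ S) (hxp : L * dist x p < (κ ^ 2)⁻¹ * M.meshSize * θ) :
    ∃ i, x ∈ M.element i ∧ p ∈ M.element i := by
  by_contra! hcon
  have hr : geodesicEDist S x p < ENNReal.ofReal ((κ ^ 2)⁻¹ * M.meshSize * θ) := by
    refine (hL x hx p hp).trans_lt ?_
    rw [edist_dist, ← ENNReal.ofReal_coe_nnreal, ← ENNReal.ofReal_mul L.coe_nonneg]
    refine (ENNReal.ofReal_lt_ofReal_iff ?_).2 hxp
    exact (by positivity : 0 ≤ L * dist x p).trans_lt hxp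
  obtain ⟨⟨γ, hγS⟩, hγ⟩ := iInf_lt_iff.1 hr
  obtain ⟨t, i, j, hxi, hxj, hti, htj⟩ := exists_mem_frontier_of_path
    (fun i => (M.isCompact_element i).isClosed) γ
    (fun t => by
      have := hγS t
      rw [← M.cover] at this
      exact this) hcon
  have hij : i ≠ j := by
    rintro rfl
    exact hxj hxi
  -- The crossing point lies in a face common to `T i` and `T j`. Since `x` is not in `T j`, it is
  -- off this face, so one of its coordinates is at least `θ` where that of the crossing point
  -- vanishes.
  obtain ⟨A, B, -, -, ⟨b, hbA, hbt⟩, hAB, -⟩ := M.conforming i j hij (γ t) hti htj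
  obtain ⟨a, ha, hax⟩ := hxi
  have hmem : ∃ k, k ∉ A ∧ a k ≠ 0 := by
    by_contra! h
    refine hxj ?_
    have h1 : x ∈ M.param i '' refFace A := ⟨a, ⟨ha, h⟩, hax⟩
    rw [hAB] at h1
    exact Set.image_mono (refFace_subset B) h1
  obtain ⟨k, hkA, hak⟩ := hmem
  have hθk : θ ≤ a k := (hθ i a ha hax k).resolve_left hak
  have h1 : θ ≤ dist a b := by
    have := abs_sub_le_dist a b k
    rw [hbA.2 k hkA, sub_zero] at this
    exact (hθk.trans (le_abs_self _)).trans this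
  have h2 : (κ ^ 2)⁻¹ * M.meshSize * θ ≤ dist x (γ t) := by
    have hd := le_dist_param hs hq hκ i ha hbA.1
    rw [hax, hbt] at hd
    refine le_trans ?_ hd
    have : 0 ≤ M.meshSize := Metric.diam_nonneg.trans (M.diam_element_le i)
    gcongr
  have h3 : edist x (γ t) ≤ eVariationOn γ Set.univ := by
    have := eVariationOn.edist_le (γ : unitInterval → Pt n) (Set.mem_univ 0) (Set.mem_univ t)
    simpa using this
  have h4 := h3.trans_lt hγ
  rw [edist_dist] at h4
  exact absurd (ENNReal.ofReal_le_ofReal h2) (not_le.2 h4)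

/-- There are no hanging nodes: a vertex that lies in a common face is one of the vertices spanning
it, and these are the same for both elements. -/
theorem eq_refVertex_of_param_eq_vertex {i j : Fin M.size} {k : Fin n} {a : Pt n}
    (ha : a ∈ refSimplex n) (h : M.param j a = M.vertex i k) : ∃ l, a = refVertex l := by
  by_cases hij : i = j
  · subst hij
    exact ⟨k, M.injOn i ha (refVertex_mem k) h⟩
  · obtain ⟨A, B, -, -, ⟨b, hb, hbx⟩, -, hv⟩ :=
      M.conforming i j hij (M.vertex i k) (M.vertex_mem_element i k) ⟨a, ha, h⟩
    have hbk : b = refVertex k := M.injOn i hb.1 (refVertex_mem k) hbx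
    have hkA : k ∈ A := by
      by_contra hk
      have := hb.2 k hk
      simp [hbk, refVertex] at this
    have h1 : M.param i (refVertex k) ∈ (fun k => M.param j (refVertex k)) '' (B : Set (Fin n)) := by
      rw [← hv]
      exact ⟨k, hkA, rfl⟩
    obtain ⟨l, -, hl⟩ := h1
    exact ⟨l, M.injOn j ha (refVertex_mem l) (h.trans hl.symm)⟩

theorem exists_vertex_eq_of_mem_element {i j : Fin M.size} {k : Fin n}
    (h : M.vertex i k ∈ M.element j) : ∃ l, M.vertex j l = M.vertex i k := by
  obtain ⟨a, ha, hax⟩ := h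
  obtain ⟨l, rfl⟩ := eq_refVertex_of_param_eq_vertex ha hax
  exact ⟨l, hax⟩

end Mesh

/-! ### Neighbourhoods contained in a single patch -/

namespace Mesh

variable {n : ℕ} {S : Set (Pt n)}

/-- The points of `S` at distance less than `r` from `x` lie in a single patch. -/
def IsCaptured (M : Mesh S) (x : Pt n) (r : ℝ) : Prop :=
  ∃ y ∈ M.nodes, ∀ p ∈ S, dist x p < r → p ∈ M.patch y

variable {M : Mesh S} {κ : ℝ} {L : ℝ≥0}

theorem IsCaptured.mono {x : Pt n} {r r' : ℝ} (h : M.IsCaptured x r) (hr : r' ≤ r) :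
    M.IsCaptured x r' := by
  obtain ⟨y, hy, h⟩ := h
  exact ⟨y, hy, fun p hp hpx => h p hp (hpx.trans_le hr)⟩

/-- Moving the centre by at most `2κθh ≤ ρh/2` costs at most half of the radius. -/
theorem IsCaptured.of_dist_le {i : Fin M.size} {a b : Pt n} {ρ θ : ℝ}
    (h : M.IsCaptured (M.param i b) (ρ * M.meshSize)) (hs : M.IsShapeRegular κ) (hκ : 1 ≤ κ)
    (ha : a ∈ refSimplex n) (hb : b ∈ refSimplex n) (hab : dist a b ≤ 2 * θ)
    (hθ : 4 * κ * θ ≤ ρ) : M.IsCaptured (M.param i a) (ρ / 2 * M.meshSize) := by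
  obtain ⟨y, hy, h⟩ := h
  refine ⟨y, hy, fun p hp hpx => h p hp ?_⟩
  have h0 : 0 ≤ M.meshSize := Metric.diam_nonneg.trans (M.diam_element_le i)
  have h1 : dist (M.param i b) (M.param i a) ≤ ρ / 2 * M.meshSize := by
    rw [dist_comm]
    calc _ ≤ κ * M.meshSize * dist a b := dist_param_le hs hκ i ha hb
      _ ≤ κ * M.meshSize * (2 * θ) := by gcongr
      _ = (4 * κ * θ) / 2 * M.meshSize := by ring
      _ ≤ _ := by gcongr
  calc _ ≤ _ := dist_triangle _ (M.param i a) _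
    _ < _ := by linarith

/-- The barycentric coordinates of a node are 0 or 1 in every element that contains it, so
`exists_common_element` applies with `θ = 1`. -/
theorem mem_patch_vertex_of_dist_lt
    (hL : ∀ x ∈ S, ∀ y ∈ S, geodesicEDist S x y ≤ L * edist x y) (hL1 : 1 ≤ L)
    (hs : M.IsShapeRegular κ) (hq : M.IsQuasiUniform κ) (hκ : 1 ≤ κ) {i : Fin M.size} {k : Fin n}
    {p : Pt n} (hp : p ∈ S) (hpy : dist (M.vertex i k) p < (κ ^ 2 * L)⁻¹ * M.meshSize) :
    p ∈ M.patch (M.vertex i k) := by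
  have hL0 : (0 : ℝ) < L := by exact_mod_cast one_pos.trans_le hL1
  have hcoord : ∀ j, ∀ a ∈ refSimplex n, M.param j a = M.vertex i k → ∀ q, a q = 0 ∨ 1 ≤ a q := by
    intro j a ha hax q
    obtain ⟨l, rfl⟩ := eq_refVertex_of_param_eq_vertex ha hax
    by_cases hql : q = l <;> simp [refVertex, hql]
  have hd : L * dist (M.vertex i k) p < (κ ^ 2)⁻¹ * M.meshSize * 1 :=
    calc _ < (L : ℝ) * ((κ ^ 2 * L)⁻¹ * M.meshSize) := by gcongr
      _ = _ := by field_simp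
  obtain ⟨j, hj, hpj⟩ := exists_common_element hL hs hq hκ hcoord
    (M.element_subset i (M.vertex_mem_element i k)) hp hd
  exact Set.mem_iUnion₂.2 ⟨j, exists_vertex_eq_of_mem_element hj, hpj⟩

theorem isCaptured_vertex
    (hL : ∀ x ∈ S, ∀ y ∈ S, geodesicEDist S x y ≤ L * edist x y) (hL1 : 1 ≤ L)
    (hs : M.IsShapeRegular κ) (hq : M.IsQuasiUniform κ) (hκ : 1 ≤ κ) (i : Fin M.size)
    (k : Fin n) : M.IsCaptured (M.vertex i k) ((κ ^ 2 * L)⁻¹ * M.meshSize) :=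
  ⟨_, M.vertex_mem_nodes i k, fun _ hp => mem_patch_vertex_of_dist_lt hL hL1 hs hq hκ hp⟩

/-- Distinct elements meet in proper faces only, so a point with positive coordinates lies in just
one element. -/
theorem isCaptured_interior [NeZero n]
    (hL : ∀ x ∈ S, ∀ y ∈ S, geodesicEDist S x y ≤ L * edist x y) (hL1 : 1 ≤ L)
    (hs : M.IsShapeRegular κ) (hq : M.IsQuasiUniform κ) (hκ : 1 ≤ κ) {i : Fin M.size}
    {a : Pt n} {θ : ℝ} (hθ0 : 0 < θ) (ha : a ∈ refSimplex n) (hθ : ∀ k, θ ≤ a k) :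
    M.IsCaptured (M.param i a) ((κ ^ 2 * L)⁻¹ * θ * M.meshSize) := by
  have hL0 : (0 : ℝ) < L := by exact_mod_cast one_pos.trans_le hL1
  have key : ∀ j, M.param i a ∈ M.element j → j = i := by
    intro j hj
    by_contra hij
    obtain ⟨A, -, hA, -, ⟨b, hb, hba⟩, -, -⟩ :=
      M.conforming i j (Ne.symm hij) (M.param i a) ⟨a, ha, rfl⟩ hj
    obtain rfl := M.injOn i hb.1 ha hba
    refine hA (Finset.eq_univ_of_forall fun k => ?_)
    by_contra hk
    have h1 := hθ k
    rw [hb.2 k hk] at h1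
    linarith
  refine ⟨M.vertex i 0, M.vertex_mem_nodes i 0, fun p hp hxp => ?_⟩
  have hcoord : ∀ j, ∀ b ∈ refSimplex n, M.param j b = M.param i a → ∀ q, b q = 0 ∨ θ ≤ b q := by
    intro j b hb hba q
    obtain rfl := key j ⟨b, hb, hba⟩
    obtain rfl := M.injOn j hb ha hba
    exact Or.inr (hθ q)
  have hd : L * dist (M.param i a) p < (κ ^ 2)⁻¹ * M.meshSize * θ :=
    calc _ < (L : ℝ) * ((κ ^ 2 * L)⁻¹ * θ * M.meshSize) := by gcongr
      _ = _ := by field_simp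
  obtain ⟨j, hj, hpj⟩ := exists_common_element hL hs hq hκ hcoord
    (M.element_subset i ⟨a, ha, rfl⟩) hp hd
  obtain rfl := key j hj
  exact M.element_subset_patch j 0 hpj

end Mesh

/-! ### Capture on triangulated surfaces and on curves -/

namespace Mesh

variable {S : Set (Pt 3)} {M : Mesh S} {κ : ℝ} {L : ℝ≥0}

/-- The elements that contain a point of the edge opposite to the vertex `m`, away from the
vertices, have this edge as an edge. -/
theorem barycentric_of_mem_edge (hs : M.IsShapeRegular κ) (hq : M.IsQuasiUniform κ) (hκ : 1 ≤ κ)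
    {i j : Fin M.size} {a b : Pt 3} {m : Fin 3} {θ : ℝ} (hθ0 : 0 < θ) (ha : a ∈ refSimplex 3)
    (ham : a m = 0) (hθ : ∀ k, k ≠ m → θ ≤ a k) (hb : b ∈ refSimplex 3)
    (hab : M.param j b = M.param i a) :
    (∀ k, b k = 0 ∨ θ / (2 * κ ^ 3) ≤ b k) ∧ ∀ k, k ≠ m → ∃ l, M.vertex j l = M.vertex i k := by
  have hκ0 : 0 < κ := by linarith
  have hh : 0 < M.meshSize := M.meshSize_pos (by norm_num) i
  by_cases hij : i = j
  · subst hij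
    obtain rfl := M.injOn i hb ha hab
    refine ⟨fun k => ?_, fun k _ => ⟨k, rfl⟩⟩
    by_cases hk : k = m
    · exact Or.inl (hk ▸ ham)
    · refine Or.inr (le_trans ?_ (hθ k hk))
      refine div_le_self hθ0.le ?_
      nlinarith [one_le_pow₀ hκ (n := 3)]
  obtain ⟨A, B, hA, hB, ⟨a', ha', haa'⟩, hAB, hv⟩ :=
    M.conforming i j hij (M.param i a) ⟨a, ha, rfl⟩ ⟨b, hb, hab⟩
  obtain rfl := M.injOn i ha'.1 ha haa'
  have hbB : b ∈ refFace B := by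
    have h1 : M.param i a' ∈ M.param j '' refFace B := hAB ▸ ⟨a', ha', rfl⟩
    obtain ⟨b', hb', hbb'⟩ := h1
    obtain rfl := M.injOn j hb'.1 hb (hbb'.trans hab.symm)
    exact hb'
  have hmA : ∀ k, k ≠ m → k ∈ A := by
    intro k hk
    by_contra hkA
    have h1 := hθ k hk
    rw [ha'.2 k hkA] at h1
    linarith
  have hAm : m ∉ A := by
    intro hm
    refine hA (Finset.eq_univ_of_forall fun k => ?_)
    by_cases hk : k = m
    · exact hk ▸ hm
    · exact hmA k hk
  have hAeq : A = Finset.univ.erase m := by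
    ext k
    simp only [Finset.mem_erase, Finset.mem_univ, and_true]
    exact ⟨fun h hk => hAm (hk ▸ h), hmA k⟩
  have hvinj : ∀ i, Function.Injective fun k => M.param i (refVertex k) := by
    intro i k l hkl
    have h1 := M.injOn i (refVertex_mem k) (refVertex_mem l) hkl
    by_contra hne
    have h2 := one_le_dist_refVertex hne
    rw [h1, dist_self] at h2
    linarith
  -- Equality of the vertex sets makes the matching face of `T j` an edge too.
  have hBcard : B.card = 2 := by
    have h1 := congrArg Set.ncard hv
    rw [Set.ncard_image_of_injective _ (hvinj i), Set.ncard_image_of_injective _ (hvinj j),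
      Set.ncard_coe_finset, Set.ncard_coe_finset] at h1
    rw [← h1, hAeq, Finset.card_erase_of_mem (Finset.mem_univ m)]
    simp
  -- The distance to the ends of the edge is transferred from `T i` to `T j` in physical space: `κ⁻²
  -- h θ ≤ κ h · 2 (1 - b k)`.
  have hfar : ∀ k ∈ B, θ / (2 * κ ^ 3) ≤ 1 - b k := by
    intro k hk
    have h1 : M.param j (refVertex k) ∈ (fun k => M.param i (refVertex k)) '' (A : Set (Fin 3)) :=
      hv ▸ ⟨k, hk, rfl⟩
    obtain ⟨k', hk', hkk'⟩ := h1
    have hk'm : k' ≠ m := fun h => hAm (h ▸ hk')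
    obtain ⟨l, hlm, hlk⟩ : ∃ l, l ≠ m ∧ l ≠ k' := by
      revert hk'm
      clear * -
      revert m k'
      decide
    have h2 : θ ≤ dist a' (refVertex k') := by
      have h3 := abs_sub_le_dist a' (refVertex k') l
      have h4 : (refVertex k' : Pt 3) l = 0 := by simp [refVertex, hlk]
      rw [h4, sub_zero] at h3
      exact ((hθ l hlm).trans (le_abs_self _)).trans h3
    have h5 := le_dist_param hs hq hκ i ha (refVertex_mem k')
    have h6 := dist_param_le hs hκ j hb (refVertex_mem k)
    simp only at hkk'
    rw [hab, ← hkk'] at h6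
    have h7 := dist_refVertex_le hb k
    have h8 : (κ ^ 2)⁻¹ * M.meshSize * θ ≤ κ * M.meshSize * (2 * (1 - b k)) :=
      calc _ ≤ (κ ^ 2)⁻¹ * M.meshSize * dist a' (refVertex k') := by gcongr
        _ ≤ κ * M.meshSize * dist b (refVertex k) := h5.trans h6
        _ ≤ _ := by gcongr
    have h9 : (κ ^ 2)⁻¹ * θ ≤ κ * (2 * (1 - b k)) := by
      refine le_of_mul_le_mul_left ?_ hh
      linarith
    rw [inv_mul_le_iff₀ (by positivity)] at h9
    rw [div_le_iff₀ (by positivity)]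
    linarith
  constructor
  · intro q
    by_cases hqB : q ∈ B
    · right
      obtain ⟨r, hr⟩ : ∃ r, B.erase q = {r} := by
        rw [← Finset.card_eq_one, Finset.card_erase_of_mem hqB, hBcard]
      have hrB : r ∈ B := Finset.mem_of_mem_erase (hr ▸ Finset.mem_singleton_self r)
      have hsum : b q + b r = 1 := by
        have h1 : ∑ k ∈ B, b k = 1 := by
          rw [← hb.2]
          exact Finset.sum_subset (Finset.subset_univ _) fun k _ hk => hbB.2 k hk
        rwa [← Finset.add_sum_erase _ _ hqB, hr, Finset.sum_singleton] at h1
      linarith [hfar r hrB]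
    · exact Or.inl (hbB.2 q hqB)
  · intro k hk
    have h1 : M.param i (refVertex k) ∈ (fun k => M.param j (refVertex k)) '' (B : Set (Fin 3)) :=
      hv ▸ ⟨k, hmA k hk, rfl⟩
    obtain ⟨l, -, hl⟩ := h1
    exact ⟨l, hl⟩

theorem isCaptured_edge
    (hL : ∀ x ∈ S, ∀ y ∈ S, geodesicEDist S x y ≤ L * edist x y) (hL1 : 1 ≤ L)
    (hs : M.IsShapeRegular κ) (hq : M.IsQuasiUniform κ) (hκ : 1 ≤ κ) {i : Fin M.size}
    {a : Pt 3} {m : Fin 3} {θ : ℝ} (hθ0 : 0 < θ) (ha : a ∈ refSimplex 3) (ham : a m = 0)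
    (hθ : ∀ k, k ≠ m → θ ≤ a k) :
    M.IsCaptured (M.param i a) ((κ ^ 2 * L)⁻¹ * (θ / (2 * κ ^ 3)) * M.meshSize) := by
  have hL0 : (0 : ℝ) < L := by exact_mod_cast one_pos.trans_le hL1
  obtain ⟨k, hk⟩ := exists_ne m
  refine ⟨M.vertex i k, M.vertex_mem_nodes i k, fun p hp hxp => ?_⟩
  have hd : L * dist (M.param i a) p < (κ ^ 2)⁻¹ * M.meshSize * (θ / (2 * κ ^ 3)) :=
    calc _ < (L : ℝ) * ((κ ^ 2 * L)⁻¹ * (θ / (2 * κ ^ 3)) * M.meshSize) := by gcongr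
      _ = _ := by field_simp
  obtain ⟨j, ⟨b, hb, hba⟩, hpj⟩ := exists_common_element hL hs hq hκ
    (fun j b hb hba => (barycentric_of_mem_edge hs hq hκ hθ0 ha ham hθ hb hba).1)
    (M.element_subset i ⟨a, ha, rfl⟩) hp hd
  exact Set.mem_iUnion₂.2
    ⟨j, (barycentric_of_mem_edge hs hq hκ hθ0 ha ham hθ hb hba).2 k hk, hpj⟩

theorem exists_isCaptured_three (hL1 : 1 ≤ L) (hκ : 1 ≤ κ) :
    ∃ δ : ℝ, 0 < δ ∧ ∀ (S : Set (Pt 3)) (M : Mesh S),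
      (∀ x ∈ S, ∀ y ∈ S, geodesicEDist S x y ≤ L * edist x y) → M.IsShapeRegular κ →
      M.IsQuasiUniform κ → ∀ x ∈ S, M.IsCaptured x (δ * M.meshSize) := by
  have hL0 : (0 : ℝ) < L := by exact_mod_cast one_pos.trans_le hL1
  have hκ0 : 0 < κ := by linarith
  -- Radii are fixed by increasing dimension of the faces: `ρ₀` serves vertices and `ρ₁` all edge
  -- points. Points with a coordinate below `θ₁` (on an edge) or `θ₂` (in a triangle) are compared
  -- with a point of a lower face; `θ = ρ / (4κ)` is the value that `IsCaptured.of_dist_le` allows.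
  obtain ⟨ρ₀, hρ₀⟩ : ∃ ρ, ρ = (κ ^ 2 * (L : ℝ))⁻¹ := ⟨_, rfl⟩
  have hρ₀pos : 0 < ρ₀ := by rw [hρ₀]; positivity
  obtain ⟨θ₁, hθ₁⟩ : ∃ θ, θ = ρ₀ / (4 * κ) := ⟨_, rfl⟩
  have hθ₁pos : 0 < θ₁ := by rw [hθ₁]; positivity
  obtain ⟨ρ₁, hρ₁⟩ : ∃ ρ, ρ = min (ρ₀ / 2) (ρ₀ * (θ₁ / (2 * κ ^ 3))) := ⟨_, rfl⟩
  have hρ₁pos : 0 < ρ₁ := by rw [hρ₁]; positivity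
  obtain ⟨θ₂, hθ₂⟩ : ∃ θ, θ = ρ₁ / (4 * κ) := ⟨_, rfl⟩
  have hθ₂pos : 0 < θ₂ := by rw [hθ₂]; positivity
  refine ⟨min (ρ₁ / 2) (ρ₀ * θ₂), by positivity, fun S M hL hs hq x hx => ?_⟩
  obtain ⟨i, a, ha, rfl⟩ := M.exists_param_eq hx
  have hh : 0 < M.meshSize := M.meshSize_pos (by norm_num) i
  have hedge : ∀ a ∈ refSimplex 3, ∀ m, a m = 0 →
      M.IsCaptured (M.param i a) (ρ₁ * M.meshSize) := by
    intro a ha m ham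
    by_cases hfar : ∀ k, k ≠ m → θ₁ ≤ a k
    · refine (isCaptured_edge hL hL1 hs hq hκ hθ₁pos ha ham hfar).mono ?_
      rw [← hρ₀]
      gcongr
      rw [hρ₁]
      exact min_le_right _ _
    · push Not at hfar
      obtain ⟨k, hkm, hk⟩ := hfar
      obtain ⟨l, hlm, hlk, hl⟩ : ∃ l, l ≠ m ∧ l ≠ k ∧ ∀ q, q = m ∨ q = k ∨ q = l := by
        revert hkm
        clear * -
        revert m k
        decide
      have hsum : a l = 1 - a k := by
        have h1 : a l + (a k + a m) = 1 := by
          rw [← ha.2, ← Finset.add_sum_erase _ _ (Finset.mem_univ l),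
            ← Finset.add_sum_erase _ _ (Finset.mem_erase.2 ⟨hlk.symm, Finset.mem_univ k⟩)]
          have h2 : (Finset.univ.erase l).erase k = {m} := by
            ext q
            simp only [Finset.mem_erase, Finset.mem_univ, and_true, Finset.mem_singleton]
            refine ⟨fun h => ?_, fun h => h ▸ ⟨hkm.symm, hlm.symm⟩⟩
            rcases hl q with h' | h' | h'
            · exact h'
            · exact absurd h' h.1
            · exact absurd h' h.2
          rw [h2, Finset.sum_singleton]
        linarith
      have h1 := dist_refVertex_le ha l
      rw [hsum, sub_sub_cancel] at h1
      refine ((isCaptured_vertex hL hL1 hs hq hκ i l).of_dist_le (θ := θ₁) hs hκ ha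
        (refVertex_mem l) (by linarith) ?_).mono ?_
      · rw [← hρ₀, hθ₁]
        exact (mul_div_cancel₀ _ (by positivity)).le
      · rw [← hρ₀]
        gcongr
        rw [hρ₁]
        exact min_le_left _ _
  by_cases hint : ∀ k, θ₂ ≤ a k
  · refine (isCaptured_interior hL hL1 hs hq hκ hθ₂pos ha hint).mono ?_
    rw [← hρ₀]
    gcongr
    exact min_le_right _ _
  · push Not at hint
    obtain ⟨m, hm⟩ := hint
    obtain ⟨k, hk⟩ := exists_ne m
    -- Shifting the small coordinate `m` to `k` moves `a` onto the edge opposite to `m`.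
    let b : Pt 3 := a + EuclideanSpace.single k (a m) - EuclideanSpace.single m (a m)
    have hb : b ∈ refSimplex 3 := by
      refine ⟨fun q => ?_, ?_⟩
      · have h1 := ha.1 q
        have h2 := ha.1 m
        by_cases hqm : q = m
        · subst hqm
          simp [b, hk.symm]
        · by_cases hqk : q = k
          · subst hqk
            simp only [b, PiLp.sub_apply, PiLp.add_apply, PiLp.single_apply, hqm, if_true,
              if_false]
            linarith
          · simp [b, hqm, hqk, h1]
      · simp [b, Finset.sum_add_distrib, ha.2, PiLp.single_apply]
    have hbm : b m = 0 := by simp [b, hk.symm]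
    refine ((hedge b hb m hbm).of_dist_le (a := a) (θ := θ₂) hs hκ ha hb ?_ ?_).mono ?_
    · refine (dist_add_single_sub_single_le a (a m) (ha.1 m) k m).trans ?_
      linarith
    · rw [hθ₂]
      exact (mul_div_cancel₀ _ (by positivity)).le
    · gcongr
      exact min_le_left _ _

theorem exists_isCaptured_two (hL1 : 1 ≤ L) (hκ : 1 ≤ κ) :
    ∃ δ : ℝ, 0 < δ ∧ ∀ (S : Set (Pt 2)) (M : Mesh S),
      (∀ x ∈ S, ∀ y ∈ S, geodesicEDist S x y ≤ L * edist x y) → M.IsShapeRegular κ →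
      M.IsQuasiUniform κ → ∀ x ∈ S, M.IsCaptured x (δ * M.meshSize) := by
  have hL0 : (0 : ℝ) < L := by exact_mod_cast one_pos.trans_le hL1
  have hκ0 : 0 < κ := by linarith
  obtain ⟨ρ, hρ⟩ : ∃ ρ, ρ = (κ ^ 2 * (L : ℝ))⁻¹ := ⟨_, rfl⟩
  have hρpos : 0 < ρ := by rw [hρ]; positivity
  obtain ⟨θ, hθ⟩ : ∃ θ, θ = ρ / (4 * κ) := ⟨_, rfl⟩
  have hθpos : 0 < θ := by rw [hθ]; positivity
  refine ⟨min (ρ / 2) (ρ * θ), by positivity, fun S M hL hs hq x hx => ?_⟩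
  obtain ⟨i, a, ha, rfl⟩ := M.exists_param_eq hx
  have hh : 0 < M.meshSize := M.meshSize_pos le_rfl i
  by_cases hint : ∀ k, θ ≤ a k
  · refine (isCaptured_interior hL hL1 hs hq hκ hθpos ha hint).mono ?_
    rw [← hρ]
    gcongr
    exact min_le_right _ _
  · push Not at hint
    obtain ⟨m, hm⟩ := hint
    -- In `Fin 2`, `1 - m` is the other index: a small coordinate `m` means closeness to the other
    -- vertex.
    have hsum : a (1 - m) = 1 - a m := by
      have h1 : a 0 + a 1 = 1 := by
        rw [← ha.2, Fin.sum_univ_two]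
      fin_cases m
      · simp only [Fin.zero_eta, sub_zero]
        linarith
      · simp only [Fin.mk_one, sub_self]
        linarith
    have h1 := dist_refVertex_le ha (1 - m)
    rw [hsum, sub_sub_cancel] at h1
    refine ((isCaptured_vertex hL hL1 hs hq hκ i (1 - m)).of_dist_le (θ := θ) hs hκ ha
      (refVertex_mem _) (by linarith) ?_).mono ?_
    · rw [← hρ, hθ]
      exact (mul_div_cancel₀ _ (by positivity)).le
    · rw [← hρ]
      gcongr
      exact min_le_left _ _

end Mesh

/-! ### Overlap of patches -/

/-- A uniform bound for the number of `ρ h`-separated points in a closed ball of radius `h`. -/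
theorem exists_card_le_of_separated (n : ℕ) {ρ : ℝ} (hρ : 0 < ρ) :
    ∃ N : ℕ, ∀ (h : ℝ), 0 < h → ∀ (t : Pt n) (s : Finset (Pt n)), (∀ y ∈ s, dist y t ≤ h) →
      (∀ y ∈ s, ∀ z ∈ s, y ≠ z → ρ * h ≤ dist y z) → s.card ≤ N := by
  -- After rescaling to the unit ball, each ball of radius `ρ/2` of a finite cover contains at most
  -- one of the points.
  obtain ⟨F, -, hF⟩ := (isCompact_closedBall (0 : Pt n) 1).finite_cover_balls
    (half_pos hρ)
  obtain ⟨hFfin, hF⟩ := hF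
  refine ⟨hFfin.toFinset.card, fun h hh t s hs hsep => ?_⟩
  have hex : ∀ y ∈ s, ∃ c ∈ F, dist (h⁻¹ • (y - t)) c < ρ / 2 := by
    intro y hy
    have h1 : h⁻¹ • (y - t) ∈ Metric.closedBall (0 : Pt n) 1 := by
      rw [mem_closedBall_zero_iff, norm_smul, norm_inv, Real.norm_of_nonneg hh.le, ← dist_eq_norm,
        inv_mul_le_iff₀ hh, mul_one]
      exact hs y hy
    obtain ⟨c, hc, hyc⟩ := Set.mem_iUnion₂.1 (hF h1)
    exact ⟨c, hc, hyc⟩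
  choose! f hfF hf using hex
  refine Finset.card_le_card_of_injOn f (fun y hy => by simpa using hfF y hy) ?_
  intro y hy z hz hyz
  by_contra hne
  have h1 := hsep y hy z hz hne
  have h2 : dist (h⁻¹ • (y - t)) (h⁻¹ • (z - t)) < ρ := by
    have h3 := hf y hy
    have h4 := hf z hz
    rw [← hyz, dist_comm] at h4
    calc _ ≤ _ := dist_triangle _ (f y) _
      _ < _ := by linarith
  have h5 : dist (h⁻¹ • (y - t)) (h⁻¹ • (z - t)) = h⁻¹ * dist y z := by
    rw [dist_smul₀, dist_sub_right, norm_inv, Real.norm_of_nonneg hh.le]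
  rw [h5, inv_mul_lt_iff₀ hh] at h2
  linarith

-- The nodes whose patches contain `t` are within `h` of `t` and are separated by `h / (κ² L)`: a
-- closer pair would share an element, but distinct vertices of one element are at least `κ⁻² h`
-- apart.
open Classical in
theorem Mesh.exists_card_patch_le {n : ℕ} (hn : 2 ≤ n) {κ : ℝ} {L : ℝ≥0} (hL1 : 1 ≤ L)
    (hκ : 1 ≤ κ) :
    ∃ N : ℕ, ∀ (S : Set (Pt n)) (M : Mesh S),
      (∀ x ∈ S, ∀ y ∈ S, geodesicEDist S x y ≤ L * edist x y) → M.IsShapeRegular κ →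
      M.IsQuasiUniform κ → ∀ t, (M.nodes.filter fun y => t ∈ M.patch y).card ≤ N := by
  have hL0 : (1 : ℝ) ≤ L := by exact_mod_cast hL1
  obtain ⟨N, hN⟩ := exists_card_le_of_separated n (ρ := (κ ^ 2 * (L : ℝ))⁻¹) (by positivity)
  refine ⟨N, fun S M hL hs hq t => ?_⟩
  rcases (M.nodes.filter fun y => t ∈ M.patch y).eq_empty_or_nonempty with he | ⟨y₀, hy₀⟩
  · simp [he]
  obtain ⟨i₀, -, -⟩ := M.exists_vertex_eq (Finset.mem_filter.1 hy₀).1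
  have hh := M.meshSize_pos hn i₀
  refine hN M.meshSize hh t _ ?_ ?_
  · intro y hy
    rw [dist_comm]
    exact M.dist_le_of_mem_patch (Finset.mem_filter.1 hy).2
  · intro y hy z hz hyz
    by_contra! hlt
    obtain ⟨i, k, rfl⟩ := M.exists_vertex_eq (Finset.mem_filter.1 hy).1
    obtain ⟨i', k', rfl⟩ := M.exists_vertex_eq (Finset.mem_filter.1 hz).1
    have h1 := mem_patch_vertex_of_dist_lt hL hL1 hs hq hκ
      (M.element_subset i' (M.vertex_mem_element i' k')) hlt
    obtain ⟨j, ⟨l, hl⟩, hj⟩ := Set.mem_iUnion₂.1 h1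
    obtain ⟨l', hl'⟩ := exists_vertex_eq_of_mem_element hj
    rw [← hl, ← hl'] at hlt hyz
    have hne : l ≠ l' := by
      rintro rfl
      exact hyz rfl
    have h2 := le_dist_param hs hq hκ j (refVertex_mem l) (refVertex_mem l')
    have h3 := one_le_dist_refVertex hne
    have h4 : (κ ^ 2 * (L : ℝ))⁻¹ * M.meshSize ≤
        (κ ^ 2)⁻¹ * M.meshSize * dist (refVertex l) (refVertex l') :=
      calc _ ≤ (κ ^ 2)⁻¹ * M.meshSize := by
            gcongr
            exact le_mul_of_one_le_right (by positivity) hL0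
        _ ≤ _ := le_mul_of_one_le_right (by positivity) h3
    exact absurd (h4.trans h2) (not_le.2 hlt)

/-! ### Growth and finiteness of the surface measure on the boundary -/

theorem exists_surfaceMeasure_ball_le {n : ℕ} (hn : 2 ≤ n) {Ω : Set (Pt n)}
    (hb : Bornology.IsBounded Ω) (hΩ : HasLipschitzBoundary Ω) :
    ∃ A : ℝ≥0, ∀ x : Pt n, ∀ r : ℝ, 0 < r →
      surfaceMeasure (frontier Ω) (Metric.ball x r) ≤ A * ENNReal.ofReal r ^ (n - 1) := by
  obtain ⟨d, rfl⟩ : ∃ d, n = d + 1 := ⟨n - 1, by omega⟩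
  have : NeZero d := ⟨by omega⟩
  obtain ⟨A, hA⟩ := exists_measure_frontier_inter_ball_le hb hΩ
  refine ⟨A, fun x r hr => ?_⟩
  rw [surfaceMeasure, Measure.restrict_apply measurableSet_ball, Set.inter_comm]
  exact hA x r hr

theorem isFiniteMeasure_surfaceMeasure_frontier {n : ℕ} (hn : 2 ≤ n) {Ω : Set (Pt n)}
    (hb : Bornology.IsBounded Ω) (hΩ : HasLipschitzBoundary Ω) :
    IsFiniteMeasure (surfaceMeasure (frontier Ω)) := by
  obtain ⟨A, hA⟩ := exists_surfaceMeasure_ball_le hn hb hΩ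
  obtain ⟨r, hr, hsub⟩ :=
    (hb.closure.subset frontier_subset_closure : Bornology.IsBounded (frontier Ω)).subset_ball_lt 0 0
  refine ⟨?_⟩
  have h1 : surfaceMeasure (frontier Ω) Set.univ ≤
      surfaceMeasure (frontier Ω) (Metric.ball 0 r) := by
    rw [surfaceMeasure, Measure.restrict_apply_univ, Measure.restrict_apply measurableSet_ball,
      Set.inter_eq_right.2 hsub]
  refine (h1.trans (hA 0 r hr)).trans_lt ?_
  exact ENNReal.mul_lt_top ENNReal.coe_lt_top (ENNReal.pow_lt_top ENNReal.ofReal_lt_top)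

/-! ### The half-order seminorm as an integral over a product -/

/-- The integrand of the half-order seminorm. -/
noncomputable def halfKernel {n : ℕ} (v : Pt n → ℝ) (p : Pt n × Pt n) : ℝ≥0∞ :=
  ENNReal.ofReal (|v p.1 - v p.2| ^ 2 / ‖p.1 - p.2‖ ^ n)

theorem aemeasurable_halfKernel {n : ℕ} {v : Pt n → ℝ} {μ : Measure (Pt n)} [SFinite μ]
    (hv : AEMeasurable v μ) : AEMeasurable (halfKernel v) (μ.prod μ) := by
  have h1 : AEMeasurable (fun p : Pt n × Pt n => v p.1) (μ.prod μ) := hv.comp_fst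
  have h2 : AEMeasurable (fun p : Pt n × Pt n => v p.2) (μ.prod μ) := hv.comp_snd
  have h3 : AEMeasurable (fun p : Pt n × Pt n => |v p.1 - v p.2|) (μ.prod μ) :=
    continuous_abs.measurable.comp_aemeasurable (h1.sub h2)
  have h4 : AEMeasurable (fun p : Pt n × Pt n => ‖p.1 - p.2‖ ^ n) (μ.prod μ) := by fun_prop
  exact ((h3.pow_const 2).div h4).ennreal_ofReal

theorem surfaceMeasure_eq_restrict {n : ℕ} {Γ τ : Set (Pt n)} (hτ : MeasurableSet τ)
    (hτΓ : τ ⊆ Γ) : surfaceMeasure τ = (surfaceMeasure Γ).restrict τ := by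
  rw [surfaceMeasure, surfaceMeasure, Measure.restrict_restrict hτ, Set.inter_eq_left.2 hτΓ]

theorem halfSeminormSq_eq_setLIntegral {n : ℕ} {Γ τ : Set (Pt n)}
    [IsFiniteMeasure (surfaceMeasure Γ)] {v : Pt n → ℝ} (hv : AEMeasurable v (surfaceMeasure Γ))
    (hτ : MeasurableSet τ) (hτΓ : τ ⊆ Γ) :
    halfSeminormSq τ v =
      ∫⁻ p in τ ×ˢ τ, halfKernel v p ∂(surfaceMeasure Γ).prod (surfaceMeasure Γ) := by
  rw [halfSeminormSq, surfaceMeasure_eq_restrict hτ hτΓ, ← Measure.prod_restrict, lintegral_prod]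
  · rfl
  · exact aemeasurable_halfKernel hv.restrict

theorem eLpNorm_two_sq {α : Type*} [MeasurableSpace α] (μ : Measure α) (f : α → ℝ) :
    eLpNorm f 2 μ ^ 2 = ∫⁻ x, ‖f x‖ₑ ^ 2 ∂μ := by
  have := eLpNorm_nnreal_pow_eq_lintegral (f := f) (μ := μ) (p := 2) (by norm_num)
  simpa using this

/-! ### Poincaré inequality on a set of small diameter -/

theorem enorm_sub_sq_le_halfKernel {n : ℕ} (v : Pt n → ℝ) {s t : Pt n} {D : ℝ}
    (h : ‖t - s‖ ≤ D) :
    ‖v t - v s‖ₑ ^ 2 ≤ ENNReal.ofReal (D ^ n) * halfKernel v (t, s) := by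
  rcases eq_or_ne t s with rfl | hts
  · simp
  · have hpos : 0 < ‖t - s‖ := norm_pos_iff.2 (sub_ne_zero.2 hts)
    rw [halfKernel, ← ENNReal.ofReal_mul (pow_nonneg (hpos.le.trans h) n), ← ofReal_norm,
      ← ENNReal.ofReal_pow (norm_nonneg _), Real.norm_eq_abs]
    refine ENNReal.ofReal_le_ofReal ?_
    rw [mul_div_assoc', le_div_iff₀ (by positivity), mul_comm]
    gcongr

/-- The two conditions on `φ` give `w t = ∫ (w t - w s) φ s ds`, an integral over `ω` only;
Cauchy–Schwarz and `|t - s| ≤ D` do the rest. -/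
theorem enorm_sq_le_of_integral_mul_eq_zero {n : ℕ} {μ : Measure (Pt n)} [IsFiniteMeasure μ]
    {w φ : Pt n → ℝ} {ω : Set (Pt n)} (hω : MeasurableSet ω) {D : ℝ}
    (hD : ∀ t ∈ ω, ∀ s ∈ ω, ‖t - s‖ ≤ D) (hw : MemLp w 2 μ) (hφ : MemLp φ 2 μ)
    (hφ1 : ∫ s, φ s ∂μ = 1) (hφω : ∀ᵐ s ∂μ, s ∉ ω → φ s = 0) (hwφ : ∫ s, w s * φ s ∂μ = 0)
    {t : Pt n} (ht : t ∈ ω) :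
    ‖w t‖ₑ ^ 2 ≤ eLpNorm φ 2 (μ.restrict ω) ^ 2 *
      (ENNReal.ofReal (D ^ n) * ∫⁻ s in ω, halfKernel w (t, s) ∂μ) := by
  have hφi : Integrable φ μ := hφ.integrable (by norm_num)
  have hwφi : Integrable (fun s => w s * φ s) μ := hw.integrable_mul hφ
  have h1 : w t = ∫ s, (w t - w s) * φ s ∂μ := by
    simp_rw [sub_mul]
    rw [integral_sub (hφi.const_mul _) hwφi, integral_const_mul, hφ1, hwφ]
    ring
  have h2 : ‖w t‖ₑ ≤ ∫⁻ s in ω, ‖w t - w s‖ₑ * ‖φ s‖ₑ ∂μ := by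
    calc ‖w t‖ₑ = ‖∫ s, (w t - w s) * φ s ∂μ‖ₑ := by rw [← h1]
      _ ≤ ∫⁻ s, ‖(w t - w s) * φ s‖ₑ ∂μ := enorm_integral_le_lintegral_enorm _
      _ = ∫⁻ s, ω.indicator (fun s => ‖w t - w s‖ₑ * ‖φ s‖ₑ) s ∂μ := by
          refine lintegral_congr_ae ?_
          filter_upwards [hφω] with s hs
          by_cases hsω : s ∈ ω
          · simp [hsω]
          · simp [hsω, hs hsω]
      _ = _ := lintegral_indicator hω _
  have hwm : AEMeasurable (fun s => ‖w t - w s‖ₑ) (μ.restrict ω) :=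
    (aemeasurable_const.sub hw.aestronglyMeasurable.aemeasurable.restrict).enorm
  have hφm : AEMeasurable (fun s => ‖φ s‖ₑ) (μ.restrict ω) :=
    hφ.aestronglyMeasurable.aemeasurable.restrict.enorm
  have h3 := ENNReal.lintegral_mul_le_Lp_mul_Lq (μ.restrict ω) Real.HolderConjugate.two_two hwm hφm
  have h4 : (∫⁻ s in ω, ‖w t - w s‖ₑ * ‖φ s‖ₑ ∂μ) ^ 2 ≤
      (∫⁻ s in ω, ‖w t - w s‖ₑ ^ 2 ∂μ) * ∫⁻ s in ω, ‖φ s‖ₑ ^ 2 ∂μ := by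
    have h5 := pow_le_pow_left₀ zero_le h3 2
    have h6 : ∀ x : ℝ≥0∞, (x ^ (1 / (2 : ℝ))) ^ 2 = x := by
      intro x
      rw [← ENNReal.rpow_natCast, ← ENNReal.rpow_mul]
      norm_num
    rw [mul_pow, h6, h6] at h5
    simpa using h5
  calc ‖w t‖ₑ ^ 2 ≤ _ := pow_le_pow_left₀ zero_le h2 2
    _ ≤ _ := h4
    _ = eLpNorm φ 2 (μ.restrict ω) ^ 2 * ∫⁻ s in ω, ‖w t - w s‖ₑ ^ 2 ∂μ := by
        rw [eLpNorm_two_sq, mul_comm]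
    _ ≤ _ := by
        gcongr
        rw [← lintegral_const_mul' _ _ ENNReal.ofReal_ne_top]
        exact setLIntegral_mono' hω fun s hs => enorm_sub_sq_le_halfKernel w (hD t ht s hs)

/-- The exponents add up to `2 (1/2 - n/2) + n = 1`, so the Poincaré constant of a patch is of order
`h`. -/
theorem ofReal_scaling_le {n : ℕ} (c : ℝ) {h : ℝ} (hh : 0 < h) :
    ENNReal.ofReal (c * h ^ (1 / 2 - (n : ℝ) / 2)) ^ 2 * ENNReal.ofReal ((2 * h) ^ n) ≤
      ENNReal.ofReal (c ^ 2 * 2 ^ n * h) := by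
  set x := h ^ (1 / 2 - (n : ℝ) / 2) with hx
  have h1 : x ^ 2 * h ^ n = h := by
    rw [hx, ← Real.rpow_natCast, ← Real.rpow_mul hh.le, ← Real.rpow_natCast h n,
      ← Real.rpow_add hh]
    have : (1 / 2 - (n : ℝ) / 2) * (2 : ℕ) + n = 1 := by
      push_cast
      ring
    rw [this, Real.rpow_one]
  -- The sign of `c` is arbitrary; for negative `c` the left side is truncated to zero.
  have h2 : ENNReal.ofReal (c * x) ^ 2 ≤ ENNReal.ofReal ((c * x) ^ 2) := by
    rw [← sq_abs, ENNReal.ofReal_pow (abs_nonneg _)]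
    gcongr
    exact le_abs_self _
  calc _ ≤ ENNReal.ofReal ((c * x) ^ 2) * ENNReal.ofReal ((2 * h) ^ n) := by gcongr
    _ = ENNReal.ofReal ((c * x) ^ 2 * (2 * h) ^ n) := by
        rw [ENNReal.ofReal_mul (sq_nonneg _)]
    _ = _ := by
        congr 1
        calc (c * x) ^ 2 * (2 * h) ^ n = c ^ 2 * 2 ^ n * (x ^ 2 * h ^ n) := by
              rw [mul_pow, mul_pow]
              ring
          _ = _ := by rw [h1]

/-! ### The contribution of distant points -/

theorem halfKernel_le {n : ℕ} (v : Pt n → ℝ) (p : Pt n × Pt n) :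
    halfKernel v p ≤ 2 * (‖v p.1‖ₑ ^ 2 * ENNReal.ofReal (1 / ‖p.1 - p.2‖ ^ n)) +
      2 * (‖v p.2‖ₑ ^ 2 * ENNReal.ofReal (1 / ‖p.1 - p.2‖ ^ n)) := by
  have h1 : ∀ x : ℝ, ‖x‖ₑ ^ 2 = ENNReal.ofReal (x ^ 2) := by
    intro x
    rw [← ofReal_norm, ← ENNReal.ofReal_pow (norm_nonneg _), Real.norm_eq_abs, sq_abs]
  have h2 : ∀ x : ℝ, 2 * ENNReal.ofReal x = ENNReal.ofReal (2 * x) := by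
    intro x
    rw [ENNReal.ofReal_mul zero_le_two, ENNReal.ofReal_ofNat]
  rw [halfKernel, h1, h1, ← ENNReal.ofReal_mul (sq_nonneg _),
    ← ENNReal.ofReal_mul (sq_nonneg _), h2, h2, ← ENNReal.ofReal_add (by positivity) (by positivity), sq_abs]
  refine ENNReal.ofReal_le_ofReal ?_
  have h3 : (v p.1 - v p.2) ^ 2 ≤ 2 * v p.1 ^ 2 + 2 * v p.2 ^ 2 := by
    nlinarith [sq_nonneg (v p.1 + v p.2)]
  calc (v p.1 - v p.2) ^ 2 / ‖p.1 - p.2‖ ^ n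
      ≤ (2 * v p.1 ^ 2 + 2 * v p.2 ^ 2) / ‖p.1 - p.2‖ ^ n := by gcongr
    _ = _ := by ring

/-- By `halfKernel_le` the integrand splits into a term with `v t` and one with `v s`. By symmetry
of the weight `g` both are bounded by its integral in one variable, which is `O(1/R)`. -/
theorem setLIntegral_halfKernel_far_le {n : ℕ} (hn : 1 ≤ n) {μ : Measure (Pt n)}
    [IsFiniteMeasure μ] {A : ℝ≥0}
    (hA : ∀ x : Pt n, ∀ r : ℝ, 0 < r → μ (Metric.ball x r) ≤ A * ENNReal.ofReal r ^ (n - 1))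
    {v : Pt n → ℝ} (hv : AEMeasurable v μ) {R : ℝ} (hR : 0 < R) :
    ∫⁻ p in {p : Pt n × Pt n | R ≤ ‖p.1 - p.2‖}, halfKernel v p ∂μ.prod μ ≤
      ENNReal.ofReal (4 * (A * 2 ^ n / R)) * ∫⁻ t, ‖v t‖ₑ ^ 2 ∂μ := by
  let F : Set (Pt n × Pt n) := {p | R ≤ ‖p.1 - p.2‖}
  have hF : MeasurableSet F := by
    refine (isClosed_le continuous_const ?_).measurableSet
    fun_prop
  let g : Pt n × Pt n → ℝ≥0∞ := F.indicator fun p => ENNReal.ofReal (1 / ‖p.1 - p.2‖ ^ n)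
  have hg : Measurable g := by
    refine Measurable.indicator ?_ hF
    fun_prop
  have hgsymm : ∀ s t, g (s, t) = g (t, s) := by
    intro s t
    simp only [g, F, Set.indicator, Set.mem_ofPred_eq, norm_sub_rev s t]
  have hgint : ∀ t, ∫⁻ s, g (t, s) ∂μ ≤ ENNReal.ofReal (A * 2 ^ n / R) := by
    intro t
    have h1 := lintegral_compl_ball_le hA t hR
    rw [Nat.sub_add_cancel hn] at h1
    refine le_trans (le_of_eq ?_) h1
    rw [← lintegral_indicator]
    · rfl
    · refine (isClosed_le continuous_const ?_).measurableSet
      fun_prop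
  have hv2 : AEMeasurable (fun t => ‖v t‖ₑ ^ 2) μ := hv.enorm.pow_const 2
  have hm1 : AEMeasurable (fun p : Pt n × Pt n => ‖v p.1‖ₑ ^ 2 * g p) (μ.prod μ) :=
    (hv2.comp_fst (ν := μ)).mul hg.aemeasurable
  have hm2 : AEMeasurable (fun p : Pt n × Pt n => ‖v p.2‖ₑ ^ 2 * g p) (μ.prod μ) :=
    (hv2.comp_snd (μ := μ)).mul hg.aemeasurable
  have hbound : ∫⁻ t, ∫⁻ s, ‖v t‖ₑ ^ 2 * g (t, s) ∂μ ∂μ ≤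
      ENNReal.ofReal (A * 2 ^ n / R) * ∫⁻ t, ‖v t‖ₑ ^ 2 ∂μ := by
    rw [← lintegral_const_mul' _ _ ENNReal.ofReal_ne_top]
    refine lintegral_mono fun t => ?_
    rw [lintegral_const_mul' _ _ (ENNReal.pow_ne_top enorm_ne_top), mul_comm]
    gcongr
    exact hgint t
  have hint1 : ∫⁻ p, ‖v p.1‖ₑ ^ 2 * g p ∂μ.prod μ ≤
      ENNReal.ofReal (A * 2 ^ n / R) * ∫⁻ t, ‖v t‖ₑ ^ 2 ∂μ := by
    rw [lintegral_prod _ hm1]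
    exact hbound
  have hint2 : ∫⁻ p, ‖v p.2‖ₑ ^ 2 * g p ∂μ.prod μ ≤
      ENNReal.ofReal (A * 2 ^ n / R) * ∫⁻ t, ‖v t‖ₑ ^ 2 ∂μ := by
    rw [lintegral_prod_symm _ hm2]
    simp only [fun s t => hgsymm s t]
    exact hbound
  calc _ = ∫⁻ p, F.indicator (halfKernel v) p ∂μ.prod μ := (lintegral_indicator hF _).symm
    _ ≤ ∫⁻ p, (2 * (‖v p.1‖ₑ ^ 2 * g p) + 2 * (‖v p.2‖ₑ ^ 2 * g p)) ∂μ.prod μ := by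
        refine lintegral_mono fun p => ?_
        by_cases hp : p ∈ F
        · simp only [g, Set.indicator_of_mem hp]
          exact halfKernel_le v p
        · simp [hp]
    _ = 2 * ∫⁻ p, ‖v p.1‖ₑ ^ 2 * g p ∂μ.prod μ + 2 * ∫⁻ p, ‖v p.2‖ₑ ^ 2 * g p ∂μ.prod μ := by
        rw [lintegral_add_left' (hm1.const_mul 2), lintegral_const_mul' _ _ (by norm_num),
          lintegral_const_mul' _ _ (by norm_num)]
    _ ≤ 2 * (ENNReal.ofReal (A * 2 ^ n / R) * ∫⁻ t, ‖v t‖ₑ ^ 2 ∂μ) +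
        2 * (ENNReal.ofReal (A * 2 ^ n / R) * ∫⁻ t, ‖v t‖ₑ ^ 2 ∂μ) := by gcongr
    _ = _ := by
        have h4 : ENNReal.ofReal 4 = 2 + 2 := by norm_num
        rw [ENNReal.ofReal_mul (by norm_num : (0 : ℝ) ≤ 4), h4]
        ring

/-! ### Summation over patches -/

namespace Mesh

variable {n : ℕ} {Γ : Set (Pt n)} (M : Mesh Γ)

theorem subset_iUnion_patch [NeZero n] : Γ ⊆ ⋃ y : M.nodes, M.patch y := by
  intro x hx
  obtain ⟨i, a, ha, rfl⟩ := M.exists_param_eq hx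
  exact Set.mem_iUnion.2
    ⟨⟨_, M.vertex_mem_nodes i 0⟩, M.element_subset_patch i 0 ⟨a, ha, rfl⟩⟩

theorem measurableSet_patch (y : Pt n) : MeasurableSet (M.patch y) :=
  (M.isCompact_patch y).measurableSet

variable [IsFiniteMeasure (surfaceMeasure Γ)] {w : Pt n → ℝ}

theorem eLpNorm_sq_le_sum [NeZero n] (hh : 0 < M.meshSize) (hΓ : MeasurableSet Γ)
    (hw : MemLp w 2 (surfaceMeasure Γ)) {c : ℝ} {φ : Pt n → Pt n → ℝ}
    (hφ : ∀ y ∈ M.nodes, MemLp (φ y) 2 (surfaceMeasure Γ))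
    (hφ1 : ∀ y ∈ M.nodes, ∫ s, φ y s ∂surfaceMeasure Γ = 1)
    (hφω : ∀ y ∈ M.nodes, ∀ᵐ s ∂surfaceMeasure Γ, s ∉ M.patch y → φ y s = 0)
    (hφc : ∀ y ∈ M.nodes, eLpNorm (φ y) 2 (surfaceMeasure (M.patch y)) ≤
      ENNReal.ofReal (c * M.meshSize ^ (1 / 2 - (n : ℝ) / 2)))
    (hwφ : ∀ y ∈ M.nodes, ∫ s, w s * φ y s ∂surfaceMeasure Γ = 0) :
    eLpNorm w 2 (surfaceMeasure Γ) ^ 2 ≤ ENNReal.ofReal (c ^ 2 * 2 ^ n * M.meshSize) *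
      ∑ y ∈ M.nodes, halfSeminormSq (M.patch y) w := by
  have hpatch : ∀ y ∈ M.nodes, ∫⁻ t in M.patch y, ‖w t‖ₑ ^ 2 ∂surfaceMeasure Γ ≤
      ENNReal.ofReal (c ^ 2 * 2 ^ n * M.meshSize) * halfSeminormSq (M.patch y) w := by
    intro y hy
    have hω := M.measurableSet_patch y
    have hD : ∀ t ∈ M.patch y, ∀ s ∈ M.patch y, ‖t - s‖ ≤ 2 * M.meshSize := by
      intro t ht s hs
      rw [← dist_eq_norm]
      have h1 := dist_triangle_right t s y
      have h2 := M.dist_le_of_mem_patch ht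
      have h3 := M.dist_le_of_mem_patch hs
      linarith
    have hres := surfaceMeasure_eq_restrict hω (M.patch_subset y)
    have hφy := hφc y hy
    rw [hres] at hφy
    rw [halfSeminormSq, hres, ← lintegral_const_mul' _ _ ENNReal.ofReal_ne_top]
    refine setLIntegral_mono' hω fun t ht => ?_
    refine (enorm_sq_le_of_integral_mul_eq_zero hω hD hw (hφ y hy) (hφ1 y hy) (hφω y hy)
      (hwφ y hy) ht).trans ?_
    rw [← mul_assoc]
    refine mul_le_mul' ?_ le_rfl
    refine le_trans ?_ (ofReal_scaling_le c hh)
    gcongr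
  -- Writing the integral as one over `Γ` allows its domain to be enlarged to the union of the
  -- patches.
  have hΓΓ : surfaceMeasure Γ = (surfaceMeasure Γ).restrict Γ :=
    surfaceMeasure_eq_restrict hΓ subset_rfl
  rw [eLpNorm_two_sq, Finset.mul_sum, hΓΓ]
  calc _ ≤ ∫⁻ t in ⋃ y : M.nodes, M.patch y, ‖w t‖ₑ ^ 2 ∂surfaceMeasure Γ :=
        lintegral_mono_set M.subset_iUnion_patch
    _ ≤ ∑' y : M.nodes, ∫⁻ t in M.patch y, ‖w t‖ₑ ^ 2 ∂surfaceMeasure Γ :=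
        lintegral_iUnion_le _ _
    _ = ∑ y ∈ M.nodes, ∫⁻ t in M.patch y, ‖w t‖ₑ ^ 2 ∂surfaceMeasure Γ := by
        rw [tsum_fintype]
        exact Finset.sum_coe_sort M.nodes
          fun y => ∫⁻ t in M.patch y, ‖w t‖ₑ ^ 2 ∂surfaceMeasure Γ
    _ ≤ _ := Finset.sum_le_sum hpatch

/-- A pair closer than `R` lies in the square of the patch that captures its first point; all other
pairs are far. -/
theorem halfSeminormSq_le_sum_add (hn : 1 ≤ n) (hΓ : MeasurableSet Γ) {A : ℝ≥0}
    (hA : ∀ x : Pt n, ∀ r : ℝ, 0 < r →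
      surfaceMeasure Γ (Metric.ball x r) ≤ A * ENNReal.ofReal r ^ (n - 1))
    {R : ℝ} (hR : 0 < R) (hM : ∀ x ∈ Γ, M.IsCaptured x R)
    (hw : AEMeasurable w (surfaceMeasure Γ)) :
    halfSeminormSq Γ w ≤ ∑ y ∈ M.nodes, halfSeminormSq (M.patch y) w +
      ENNReal.ofReal (4 * (A * 2 ^ n / R)) * eLpNorm w 2 (surfaceMeasure Γ) ^ 2 := by
  have hsub : Γ ×ˢ Γ ⊆ (⋃ y : M.nodes, M.patch y ×ˢ M.patch y) ∪
      {p : Pt n × Pt n | R ≤ ‖p.1 - p.2‖} := by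
    rintro ⟨t, s⟩ ⟨ht, hs⟩
    by_cases hts : R ≤ ‖t - s‖
    · exact Or.inr hts
    · left
      obtain ⟨y, hy, h⟩ := hM t ht
      refine Set.mem_iUnion.2 ⟨⟨y, hy⟩, h t ht (by simpa using hR), h s hs ?_⟩
      rw [dist_eq_norm]
      exact not_le.1 hts
  rw [halfSeminormSq_eq_setLIntegral hw hΓ subset_rfl, eLpNorm_two_sq]
  refine (lintegral_mono_set hsub).trans ((lintegral_union_le _ _ _).trans ?_)
  refine add_le_add ?_ (setLIntegral_halfKernel_far_le hn hA hw hR)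
  refine (lintegral_iUnion_le _ _).trans (le_of_eq ?_)
  rw [tsum_fintype, ← Finset.sum_coe_sort M.nodes]
  exact Finset.sum_congr rfl fun y _ =>
    (halfSeminormSq_eq_setLIntegral hw (M.measurableSet_patch y) (M.patch_subset y)).symm

-- A pair lies in the square of at most `N` patches, because its first point lies in at most `N` of
-- them.
open Classical in
theorem sum_halfSeminormSq_le {N : ℕ}
    (hN : ∀ t, (M.nodes.filter fun y => t ∈ M.patch y).card ≤ N)
    (hw : AEMeasurable w (surfaceMeasure Γ)) :
    ∑ y ∈ M.nodes, halfSeminormSq (M.patch y) w ≤ N * halfSeminormSq Γ w := by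
  have hk := aemeasurable_halfKernel hw
  have hm : ∀ y, MeasurableSet (M.patch y ×ˢ M.patch y) := fun y =>
    (M.measurableSet_patch y).prod (M.measurableSet_patch y)
  calc _ = ∑ y ∈ M.nodes, ∫⁻ p, (M.patch y ×ˢ M.patch y).indicator (halfKernel w) p
          ∂(surfaceMeasure Γ).prod (surfaceMeasure Γ) := by
        refine Finset.sum_congr rfl fun y _ => ?_
        rw [halfSeminormSq_eq_setLIntegral hw (M.measurableSet_patch y) (M.patch_subset y),
          lintegral_indicator (hm y)]
    _ = ∫⁻ p, ∑ y ∈ M.nodes, (M.patch y ×ˢ M.patch y).indicator (halfKernel w) p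
          ∂(surfaceMeasure Γ).prod (surfaceMeasure Γ) :=
        (lintegral_finsetSum' _ fun y _ => hk.indicator (hm y)).symm
    _ ≤ ∫⁻ p, N * halfKernel w p ∂(surfaceMeasure Γ).prod (surfaceMeasure Γ) := by
        refine lintegral_mono fun p => ?_
        calc _ ≤ ∑ y ∈ M.nodes, if p.1 ∈ M.patch y then halfKernel w p else 0 := by
              refine Finset.sum_le_sum fun y _ => ?_
              by_cases hp : p ∈ M.patch y ×ˢ M.patch y
              · simp [Set.indicator_of_mem hp, hp.1]
              · simp [Set.indicator_of_notMem hp]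
          _ = (M.nodes.filter fun y => p.1 ∈ M.patch y).card * halfKernel w p := by
              rw [← Finset.sum_filter, Finset.sum_const, nsmul_eq_mul]
          _ ≤ _ := by
              gcongr
              exact hN p.1
    _ = N * ∫⁻ p, halfKernel w p ∂(surfaceMeasure Γ).prod (surfaceMeasure Γ) :=
        lintegral_const_mul' _ _ (ENNReal.natCast_ne_top N)
    _ = _ := by
        rw [lintegral_prod _ hk]
        rfl

end Mesh

/-! ### Uniform constants and the norm equivalence -/

theorem Mesh.exists_isCaptured {n : ℕ} (hn : n = 2 ∨ n = 3) {κ : ℝ} {L : ℝ≥0} (hL1 : 1 ≤ L)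
    (hκ : 1 ≤ κ) :
    ∃ δ : ℝ, 0 < δ ∧ ∀ (S : Set (Pt n)) (M : Mesh S),
      (∀ x ∈ S, ∀ y ∈ S, geodesicEDist S x y ≤ L * edist x y) → M.IsShapeRegular κ →
      M.IsQuasiUniform κ → ∀ x ∈ S, M.IsCaptured x (δ * M.meshSize) := by
  rcases hn with rfl | rfl
  · exact exists_isCaptured_two hL1 hκ
  · exact exists_isCaptured_three hL1 hκ

theorem halfNormSq_empty {n : ℕ} (v : Pt n → ℝ) : halfNormSq (∅ : Set (Pt n)) v = 0 := by
  simp [halfNormSq, halfSeminormSq, surfaceMeasure]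

end TraceNorm

open TraceNorm in
theorem mainTheorem1 (n : ℕ) (hn : n = 2 ∨ n = 3) (Ω : Set (Pt n)) (hΩ : IsAdmissibleDomain Ω)
    (κ c : ℝ) :
    ∃ C : ℝ≥0, 0 < C ∧
      ∀ M : Mesh (frontier Ω), M.IsShapeRegular κ → M.IsQuasiUniform κ →
      ∀ φ : Pt n → Pt n → ℝ,
        (∀ y ∈ M.nodes,
          MemLp (φ y) 2 (surfaceMeasure (frontier Ω)) ∧
          ∫ s, φ y s ∂surfaceMeasure (frontier Ω) = 1 ∧
          (∀ᵐ s ∂surfaceMeasure (frontier Ω), s ∉ M.patch y → φ y s = 0) ∧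
          ENNReal.ofReal (c⁻¹ * M.meshSize ^ (1 / 2 - (n : ℝ) / 2)) ≤
            eLpNorm (φ y) 2 (surfaceMeasure (M.patch y)) ∧
          eLpNorm (φ y) 2 (surfaceMeasure (M.patch y)) ≤
            ENNReal.ofReal (c * M.meshSize ^ (1 / 2 - (n : ℝ) / 2))) →
      ∀ w : Pt n → ℝ, MemHalf (frontier Ω) w →
        (∀ y ∈ M.nodes, ∫ s, w s * φ y s ∂surfaceMeasure (frontier Ω) = 0) →
        halfNormSq (frontier Ω) w ≤ C * ∑ y ∈ M.nodes, halfSeminormSq (M.patch y) w ∧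
          ∑ y ∈ M.nodes, halfSeminormSq (M.patch y) w ≤ C * halfNormSq (frontier Ω) w := by
  have hn2 : 2 ≤ n := by omega
  have : NeZero n := ⟨by omega⟩
  have hΓb : Bornology.IsBounded (frontier Ω) :=
    hΩ.isBounded.closure.subset frontier_subset_closure
  -- Meshes without elements, which cover the empty set only, satisfy the claim with any constant.
  have hempty : ∀ M : Mesh (frontier Ω), IsEmpty (Fin M.size) → ∀ (C : ℝ≥0) (w : Pt n → ℝ),
      halfNormSq (frontier Ω) w ≤ C * ∑ y ∈ M.nodes, halfSeminormSq (M.patch y) w ∧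
        ∑ y ∈ M.nodes, halfSeminormSq (M.patch y) w ≤ C * halfNormSq (frontier Ω) w := by
    intro M hM C w
    have h1 : frontier Ω = ∅ :=
      Set.eq_empty_of_forall_notMem fun x hx => hM.elim (M.exists_param_eq hx).choose
    have h2 : M.nodes = ∅ :=
      Finset.eq_empty_of_forall_notMem fun y hy => hM.elim (M.exists_vertex_eq hy).choose
    rw [h2, Finset.sum_empty, mul_zero]
    refine ⟨?_, zero_le⟩
    have h3 : ∀ Γ : Set (Pt n), Γ = ∅ → halfNormSq Γ w ≤ 0 := by
      rintro Γ rfl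
      exact (halfNormSq_empty w).le
    exact h3 _ h1
  by_cases hκ : 1 ≤ κ
  swap
  · refine ⟨1, one_pos, fun M _ hq φ _ w _ _ => hempty M ⟨fun i => hκ (hq.one_le hn2 i)⟩ 1 w⟩
  have hfin := isFiniteMeasure_surfaceMeasure_frontier hn2 hΩ.isBounded hΩ.lipschitz
  obtain ⟨A, hA⟩ := exists_surfaceMeasure_ball_le hn2 hΩ.isBounded hΩ.lipschitz
  obtain ⟨L, hL⟩ : ∃ L : ℝ≥0, 1 ≤ L ∧ ∀ x ∈ frontier Ω, ∀ y ∈ frontier Ω,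
      geodesicEDist (frontier Ω) x y ≤ L * edist x y := by
    obtain ⟨L, hL⟩ := hΩ.nondegenerate
    refine ⟨max L 1, le_max_right _ _, fun x hx y hy => (hL x hx y hy).trans ?_⟩
    gcongr
    exact le_max_left _ _
  obtain ⟨hL1, hL⟩ := hL
  obtain ⟨δ, hδ, hcap⟩ := Mesh.exists_isCaptured hn hL1 hκ
  obtain ⟨N, hN⟩ := Mesh.exists_card_patch_le hn2 hL1 hκ
  -- As `h ≤ D`, the factor `h` in the `L²` bound can be absorbed into a constant. The three terms
  -- of `C₁` are for the `L²` norm, the near pairs and the far pairs.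
  let D := Metric.diam (frontier Ω)
  have hD : 0 ≤ D := Metric.diam_nonneg
  let C₁ : ℝ := c ^ 2 * 2 ^ n * D + 1 + 4 * (A * 2 ^ n / δ) * (c ^ 2 * 2 ^ n)
  have hC₁ : 0 < C₁ := by positivity
  refine ⟨max (Real.toNNReal C₁) N, lt_max_of_lt_left (Real.toNNReal_pos.2 hC₁),
    fun M hs hq φ hφ w hw hwφ => ?_⟩
  rcases isEmpty_or_nonempty (Fin M.size) with hM | ⟨⟨i⟩⟩
  · exact hempty M hM _ w
  have hh : 0 < M.meshSize := M.meshSize_pos hn2 i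
  have hhD : M.meshSize ≤ D := by
    have : Nonempty (Fin M.size) := ⟨i⟩
    exact ciSup_le fun j => Metric.diam_mono (M.element_subset j) hΓb
  have hΓ : MeasurableSet (frontier Ω) := isClosed_frontier.measurableSet
  have hwm := hw.1.aestronglyMeasurable.aemeasurable
  constructor
  · have hL2 := M.eLpNorm_sq_le_sum hh hΓ hw.1 (c := c) (fun y hy => (hφ y hy).1)
      (fun y hy => (hφ y hy).2.1) (fun y hy => (hφ y hy).2.2.1)
      (fun y hy => (hφ y hy).2.2.2.2) hwφ
    have hsemi := M.halfSeminormSq_le_sum_add (by omega) hΓ hA (mul_pos hδ hh)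
      (hcap _ M hL hs hq) hwm
    set Q := ∑ y ∈ M.nodes, halfSeminormSq (M.patch y) w
    -- The factor `1/h` of the far pairs cancels the `h` of the Poincaré inequality.
    have hprod : ENNReal.ofReal (4 * (A * 2 ^ n / (δ * M.meshSize))) *
        ENNReal.ofReal (c ^ 2 * 2 ^ n * M.meshSize) =
          ENNReal.ofReal (4 * (A * 2 ^ n / δ) * (c ^ 2 * 2 ^ n)) := by
      rw [← ENNReal.ofReal_mul (by positivity)]
      congr 1
      field_simp
    calc halfNormSq (frontier Ω) w
        ≤ ENNReal.ofReal (c ^ 2 * 2 ^ n * M.meshSize) * Q +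
          (Q + ENNReal.ofReal (4 * (A * 2 ^ n / (δ * M.meshSize))) *
            (ENNReal.ofReal (c ^ 2 * 2 ^ n * M.meshSize) * Q)) := by
          refine add_le_add hL2 (hsemi.trans ?_)
          gcongr
      _ = (ENNReal.ofReal (c ^ 2 * 2 ^ n * M.meshSize) + 1 +
          ENNReal.ofReal (4 * (A * 2 ^ n / δ) * (c ^ 2 * 2 ^ n))) * Q := by
          rw [← hprod]
          ring
      _ ≤ (ENNReal.ofReal (c ^ 2 * 2 ^ n * D) + 1 +
          ENNReal.ofReal (4 * (A * 2 ^ n / δ) * (c ^ 2 * 2 ^ n))) * Q := by gcongr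
      _ = ENNReal.ofReal C₁ * Q := by
          rw [← ENNReal.ofReal_one, ← ENNReal.ofReal_add (by positivity) zero_le_one,
            ← ENNReal.ofReal_add (by positivity) (by positivity)]
      _ ≤ _ := by
          gcongr
          exact ENNReal.coe_le_coe.2 (le_max_left _ _)
  · refine (M.sum_halfSeminormSq_le (hN _ M hL hs hq) hwm).trans ?_
    refine mul_le_mul' ?_ le_add_self
    rw [← ENNReal.coe_natCast]
    exact ENNReal.coe_le_coe.2 (le_max_right _ _)
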